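/- Let $G$ be a simple undirected graph on $n$ vertices and $k\ge 1$ an integer. $(G,k)$ is a yes-instance of the $k$-vertex cover problem if $G$ has a vertex cover of size at most $k$, and a no-instance otherwise. Let $\mathcal I^{\mathrm{vc}}_{(G,k)}$ be the set of all instances $(G',k')$ that the following classical kernelization can return. Choose a maximal (with respect to inclusion) matching $M$ of $G$; if $|M|\ge k+1$, report that $(G,k)$ is a no-instance. Otherwise start with $(G',k')=(G,k)$ and go once through the endpoints $v$ of the edges of $M$, in any order; whenever $v$ has degree at least $k+1$, replace $(G',k')$ by $(G'-v,k'-1)$, where $G'-v$ is the subgraph of $G'$ induced by $V(G')\setminus\{v\}$. Finally return $(G',k')$; here $k'$ is an integer, possibly negative. (The degree of $v$ may be measured either always in the input graph $G$ or always in the current graph $G'$; the theorem holds for each of these two conventions.) A quantum query algorithm with $T$ queries in the adjacency matrix model applies $U_T O_G U_{T-1} O_G\cdots O_G U_0$ to a fixed initial basis state and measures the result in the computational basis. The unitary operators $U_0,\dots,U_T$ may depend on $n$ and $k$ but not on $G$; the oracle $O_G$ maps $|e\rangle|q\rangle$ to $|e\rangle|q\oplus E_G(e)\rangle$, where $e$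 is an unordered pair of distinct vertices and $E_G(e)=1$ if and only if $e\in E(G)$, and it acts as the identity on the other registers and when the query register is idle. The output is a classical bit string determined by the measurement outcome. Theorem. There is a constant $C$ such that, for all integers $n\ge 0$ and $k\ge 1$, there is a quantum query algorithm with at most $C\,(\sqrt{k}\,n+k^{3/2}\sqrt{n})$ queries that has the following property. For every graph $G$ on $n$ vertices, with probability at least $2/3$, the algorithm either outputs, encoded as a classical bit string, an instance $(G',k')\in\mathcal I^{\mathrm{vc}}_{(G,k)}$, or reports that $(G,k)$ is a no-instance, and such a report counts as correct only if $(G,k)$ is indeed a no-instance. -/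

import Mathlib

/-! ### The vertex cover problem and the classical kernelization -/

namespace VCKernel

/-- `(G, k)` is a yes-instance of the `k`-vertex cover problem. -/
def IsYesInstance {n : ℕ} (G : SimpleGraph (Fin n)) (k : ℕ) : Prop :=
  ∃ S : Finset (Fin n), S.card ≤ k ∧ G.IsVertexCover (S : Set (Fin n))

/-- `M` is a maximal matching of `G`: a matching that is not a proper part of another matching.
Its vertex set `M.verts` is the set `V(M)` of all endpoints of its edges. -/
def IsMaximalMatching {n : ℕ} {G : SimpleGraph (Fin n)} (M : G.Subgraph) : Prop :=
  Maximal SimpleGraph.Subgraph.IsMatching M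

/-- The graph in which the kernelization measures the degree of the vertex under consideration:
the input graph `G`, or the graph `G'` that remains when the vertex is considered. -/
inductive DegreeGraph where
  | input
  | current

/-- The degree of `v` in the graph chosen by `d`; `H` is the remaining graph. -/
noncomputable def degreeIn {n : ℕ} {G : SimpleGraph (Fin n)} (d : DegreeGraph)
    (H : G.Subgraph) (v : Fin n) : ℕ :=
  match d with
  | DegreeGraph.input => (G.neighborSet v).ncard
  | DegreeGraph.current => (H.neighborSet v).ncard

open Classical in
/-- One step of the kernelization: if `v` has degree at least `k + 1`, replace the instance
`(G', k')` by `(G' - v, k' - 1)`; otherwise keep it. -/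
noncomputable def eliminate {n : ℕ} {G : SimpleGraph (Fin n)} (d : DegreeGraph) (k : ℕ)
    (I : G.Subgraph × ℤ) (v : Fin n) : G.Subgraph × ℤ :=
  if k + 1 ≤ degreeIn d I.1 v then (I.1.deleteVerts {v}, I.2 - 1) else I

/-- The set of all instances `(G', k')` that the classical kernelization can return on `(G, k)`:
choose a maximal matching `M`, which must have at most `k` edges (otherwise the kernelization
rejects), start from `(G, k)` and apply `eliminate` to the vertices of `M` in some order,
each of them once. -/
def kernels {n : ℕ} (d : DegreeGraph) (G : SimpleGraph (Fin n)) (k : ℕ) :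
    Set (G.Subgraph × ℤ) :=
  {I | ∃ M : G.Subgraph, IsMaximalMatching M ∧ M.edgeSet.ncard ≤ k ∧
    ∃ l : List (Fin n), l.Nodup ∧ (∀ v, v ∈ l ↔ v ∈ M.verts) ∧
      I = l.foldl (eliminate d k) ((⊤ : G.Subgraph), (k : ℤ))}

/-! ### Instances as bit strings -/

/-- The binary code of an integer: a sign bit and the binary digits of the absolute value. -/
def encodeInt (z : ℤ) : List Bool :=
  decide (z < 0) :: z.natAbs.bits

open Classical in
/-- The bit string of an instance `(G', k')`: the bit `true`, the indicator vector of `V(G')`,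
the adjacency matrix of `G'` (`n * n` bits, row by row), and the code of `k'`. -/
noncomputable def encodeInstance {n : ℕ} {G : SimpleGraph (Fin n)} (I : G.Subgraph × ℤ) :
    List Bool :=
  true :: (List.ofFn (fun v : Fin n => decide (v ∈ I.1.verts)) ++
    (List.ofFn (fun e : Fin (n * n) =>
      decide (I.1.Adj (finProdFinEquiv.symm e).1 (finProdFinEquiv.symm e).2)) ++
    encodeInt I.2))

/-- The bit string that reports that the input is a no-instance. -/
def noString : List Bool := [false]

/-- The code of an instance determines its vertex set, its edges and its parameter. -/
theorem encodeInstance_injective {n : ℕ} {G₁ G₂ : SimpleGraph (Fin n)}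
    {I₁ : G₁.Subgraph × ℤ} {I₂ : G₂.Subgraph × ℤ}
    (h : encodeInstance I₁ = encodeInstance I₂) :
    I₁.1.verts = I₂.1.verts ∧ I₁.1.Adj = I₂.1.Adj ∧ I₁.2 = I₂.2 := by
  have hbits : ∀ a b : ℕ, a.bits = b.bits → a = b := by
    intro a
    induction a using Nat.binaryRec' with
    | zero =>
      intro b
      induction b using Nat.binaryRec' with
      | zero => simp
      | bit c m hm _ => simp [Nat.bits_append_bit _ _ hm]
    | bit c m hm ih =>
      intro b
      induction b using Nat.binaryRec' with
      | zero => simp [Nat.bits_append_bit _ _ hm]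
      | bit c' m' hm' _ =>
        intro h
        rw [Nat.bits_append_bit _ _ hm, Nat.bits_append_bit _ _ hm'] at h
        obtain ⟨h1, h2⟩ := List.cons.inj h
        rw [h1, ih _ h2]
  unfold encodeInstance at h
  have h1 := (List.cons.inj h).2
  obtain ⟨ha, h2⟩ := List.append_inj h1 (by simp)
  obtain ⟨hb, hc⟩ := List.append_inj h2 (by simp)
  have ha' := List.ofFn_injective ha
  have hb' := List.ofFn_injective hb
  refine ⟨?_, ?_, ?_⟩
  · ext v
    simpa using congrFun ha' v
  · ext u v
    simpa using congrFun hb' (finProdFinEquiv (u, v))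
  · obtain ⟨hs, hn⟩ := List.cons.inj hc
    have hn' := hbits _ _ hn
    have hs' : I₁.2 < 0 ↔ I₂.2 < 0 := by simpa using hs
    omega

/-- The correct outputs on the input `(G, k)`: the bit strings of the instances in
`kernels d G k`, and `noString` in case `(G, k)` is a no-instance. -/
def correctOutputs {n : ℕ} (d : DegreeGraph) (G : SimpleGraph (Fin n)) (k : ℕ) :
    Set (List Bool) :=
  {w | (∃ I ∈ kernels d G k, w = encodeInstance I) ∨ (w = noString ∧ ¬ IsYesInstance G k)}

end VCKernel

/-! ### Quantum query algorithms in the adjacency matrix model -/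

namespace QuantumQuery

/-- The unordered pairs of distinct vertices. -/
abbrev VertexPair (n : ℕ) : Type := {e : Sym2 (Fin n) // ¬ e.IsDiag}

/-- The labels of the computational basis: the query register, which holds a vertex pair or is
idle (`none`), the answer qubit, and a work register with label set `W`. The idle label keeps the
state space nonzero for graphs without vertex pairs. -/
abbrev BasisLabel (n : ℕ) (W : Type) : Type := Option (VertexPair n) × Bool × W

open Classical in
/-- The oracle function: whether the queried pair is an edge of `G` (`false` when idle). -/
noncomputable def answer {n : ℕ} (G : SimpleGraph (Fin n)) : Option (VertexPair n) → Bool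
  | none => false
  | some e => decide (e.1 ∈ G.edgeSet)

/-- The oracle operator `|e⟩|q⟩|w⟩ ↦ |e⟩|q ⊕ E(e)⟩|w⟩`, on amplitude vectors. -/
noncomputable def oracle {n : ℕ} {W : Type} (G : SimpleGraph (Fin n))
    (ψ : BasisLabel n W → ℂ) : BasisLabel n W → ℂ :=
  fun b => ψ (b.1, xor b.2.1 (answer G b.1), b.2.2)

/-- A quantum query algorithm on `n`-vertex graphs with `T` queries: an initial basis state,
unitary operators `U 0, …, U T`, and a rule that reads a classical bit string off the outcome of
the final measurement in the computational basis. None of this depends on the input graph. -/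
structure QueryAlgorithm (n T : ℕ) where
  W : Type
  [fintypeW : Fintype W]
  [decEqW : DecidableEq W]
  init : BasisLabel n W
  U : Fin (T + 1) → Matrix.unitaryGroup (BasisLabel n W) ℂ
  readout : BasisLabel n W → List Bool

attribute [instance] QueryAlgorithm.fintypeW QueryAlgorithm.decEqW

namespace QueryAlgorithm

/-- The state `U t · O · U (t-1) · O ⋯ O · U 0 |init⟩` after `t` oracle calls. -/
noncomputable def state {n T : ℕ} (A : QueryAlgorithm n T) (G : SimpleGraph (Fin n)) :
    (t : ℕ) → t < T + 1 → (BasisLabel n A.W → ℂ)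
  | 0, h => (A.U ⟨0, h⟩).1.mulVec (Pi.single A.init 1)
  | t + 1, h => (A.U ⟨t + 1, h⟩).1.mulVec (oracle G (A.state G t (Nat.lt_of_succ_lt h)))

open Classical in
/-- The probability that the bit string output by `A` on the input graph `G` lies in `S`. -/
noncomputable def prob {n T : ℕ} (A : QueryAlgorithm n T) (G : SimpleGraph (Fin n))
    (S : Set (List Bool)) : ℝ :=
  ∑ b with A.readout b ∈ S, ‖A.state G T (Nat.lt_succ_self T) b‖ ^ 2

end QueryAlgorithm

end QuantumQuery

/-! Two rounds of repeated Grover search learn enough of `G` to run the classical kernelization. The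
first grows a matching `H` until it is maximal or has `k + 1` edges. At most `k + 1` finds among at
most `n ^ 2` candidates cost `O(√(n ^ 2 * k)) = O(√k * n)` queries. With `k + 1` edges a no-instance
is reported.

Otherwise the second round searches for edges at the at most `2 * k` endpoints of `H`, dropping an
endpoint once `3 * k + 1` of its edges are known. There are at most `2 * k * n` candidates and at
most `2 * k * (3 * k + 1)` finds, which costs `O(k ^ (3 / 2) * √n)`. Since at most `2 * k` vertices
are ever deleted, a saturated endpoint keeps degree at least `k + 1` and is deleted for sure; every
other endpoint is completely known. So the kernelization of the known edges deletes the same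
vertices as that of `G`, and since every edge of `G` meets `H`, the remaining graphs agree too
(`encodeInstance_foldl_eq`).

Repeated search (`exists_repeatedSearch`) makes Grover attempts of slowly growing length and resets
the length after each find. A potential function bounds the expected cost by `O(√N * ∑ 1 / √i)`, and
a fixed budget ten times larger fails with probability at most `1 / 10`. The two rounds together
fail with probability at most `1 / 5`.

On the quantum side, state families with equal Gram matrices differ by a unitary independent of the
input (`exists_unitary_mulVec_eq`). Hence algorithms are composed at the level of Gram matrices of
real state families (`GramReachable`, `SolvesWithin`), where only queries count, and become circuits
once, in `SolvesWithin.exists_queryAlgorithm`. -/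

open QuantumQuery

/-- Vector families with the same Gram matrix are related by a unitary operator. -/
theorem exists_unitary_mulVec_eq {ι L : Type*} [Fintype ι] [Fintype L] [DecidableEq L]
    (φ ψ : ι → L → ℂ)
    (h : ∀ i j, ∑ b, star (φ i b) * φ j b = ∑ b, star (ψ i b) * ψ j b) :
    ∃ U : Matrix.unitaryGroup L ℂ, ∀ i, U.1.mulVec (φ i) = ψ i := by
  classical
  let Φ : (ι → ℂ) →ₗ[ℂ] EuclideanSpace ℂ L :=
    Fintype.linearCombination ℂ (fun i => WithLp.toLp 2 (φ i))
  let Ψ : (ι → ℂ) →ₗ[ℂ] EuclideanSpace ℂ L :=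
    Fintype.linearCombination ℂ (fun i => WithLp.toLp 2 (ψ i))
  have hinner : ∀ i j, inner ℂ (WithLp.toLp 2 (φ i)) (WithLp.toLp 2 (φ j)) =
      inner ℂ (WithLp.toLp 2 (ψ i)) (WithLp.toLp 2 (ψ j)) := by
    intro i j
    simpa [PiLp.inner_apply, mul_comm] using h i j
  have hnorm : ∀ c, ‖Φ c‖ = ‖Ψ c‖ := by
    intro c
    have : inner ℂ (Φ c) (Φ c) = inner ℂ (Ψ c) (Ψ c) := by
      simp only [Φ, Ψ, Fintype.linearCombination_apply, sum_inner, inner_sum, inner_smul_left,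
        inner_smul_right, hinner]
    rw [inner_self_eq_norm_sq_to_K, inner_self_eq_norm_sq_to_K] at this
    have h2 : ‖Φ c‖ ^ 2 = ‖Ψ c‖ ^ 2 := by exact_mod_cast this
    exact (pow_left_inj₀ (norm_nonneg _) (norm_nonneg _) two_ne_zero).1 h2
  -- Equal norms make the map `Φ c ↦ Ψ c` well defined, hence an isometry from the span of the `φ
  -- i`; `LinearIsometry.extend` then extends it to the whole space.
  have hker : LinearMap.ker Φ ≤ LinearMap.ker Ψ := by
    intro c hc
    rw [LinearMap.mem_ker, ← norm_eq_zero] at hc ⊢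
    rw [← hnorm, hc]
  let g : LinearMap.range Φ →ₗ[ℂ] EuclideanSpace ℂ L :=
    ((LinearMap.ker Φ).liftQ Ψ hker).comp Φ.quotKerEquivRange.symm.toLinearMap
  have hg : ∀ c (hc : Φ c ∈ LinearMap.range Φ), g ⟨Φ c, hc⟩ = Ψ c := by
    intro c hc
    have : Φ.quotKerEquivRange.symm ⟨Φ c, hc⟩ = (LinearMap.ker Φ).mkQ c :=
      Φ.quotKerEquivRange_symm_apply_image c hc
    simp [g, this]
  let S : LinearMap.range Φ →ₗᵢ[ℂ] EuclideanSpace ℂ L :=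
    { toLinearMap := g
      norm_map' := by
        rintro ⟨x, hx⟩
        obtain ⟨c, rfl⟩ := LinearMap.mem_range.1 hx
        exact (congrArg norm (hg c hx)).trans (hnorm c).symm }
  let V := S.extend
  have hV : ∀ i, V (WithLp.toLp 2 (φ i)) = WithLp.toLp 2 (ψ i) := by
    intro i
    have e1 : Φ (Pi.single i 1) = WithLp.toLp 2 (φ i) := by
      simp [Φ, Fintype.linearCombination_apply_single]
    have e2 : Ψ (Pi.single i 1) = WithLp.toLp 2 (ψ i) := by
      simp [Ψ, Fintype.linearCombination_apply_single]
    rw [← e1, ← e2]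
    exact (S.extend_apply ⟨Φ (Pi.single i 1), LinearMap.mem_range_self _ _⟩).trans (hg _ _)
  let U : Matrix L L ℂ := Matrix.of fun i j => V (EuclideanSpace.single j 1) i
  have hU : U ∈ Matrix.unitaryGroup L ℂ := by
    rw [Matrix.mem_unitaryGroup_iff']
    ext i j
    have h1 : inner ℂ (V (EuclideanSpace.single i 1)) (V (EuclideanSpace.single j 1)) =
        inner ℂ (EuclideanSpace.single i (1 : ℂ)) (EuclideanSpace.single j (1 : ℂ)) :=
      V.inner_map_map _ _
    rw [PiLp.inner_apply] at h1
    simp only [Matrix.mul_apply, Matrix.star_apply, U, Matrix.of_apply, Matrix.one_apply]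
    simp only [EuclideanSpace.inner_single_left, map_one, one_mul] at h1
    rw [show (if i = j then (1 : ℂ) else 0) = (EuclideanSpace.single j (1 : ℂ)).ofLp i by
      simp, ← h1]
    refine Finset.sum_congr rfl fun x _ => ?_
    simp [mul_comm]
  refine ⟨⟨U, hU⟩, fun i => ?_⟩
  have hx : WithLp.toLp 2 (φ i) = ∑ j, φ i j • EuclideanSpace.single j (1 : ℂ) := by
    ext a
    simp [Pi.single_apply]
  ext a
  have := congrArg (fun v => v.ofLp a) (hV i)
  simp only at this
  rw [← this, hx, map_sum]
  simp [Matrix.mulVec, dotProduct, U, mul_comm]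

/-! ### Query algorithms up to input-independent isometries -/

namespace QuantumQuery

variable {n : ℕ}

/-- The Gram matrix of a family of real vectors. -/
def gram {γ L : Type*} [Fintype L] (Ψ : γ → L → ℝ) : γ → γ → ℝ :=
  fun x y => ∑ b, Ψ x b * Ψ y b

/-- The eigenvalue of the phase oracle of `G` on the query `e`. -/
noncomputable def phase (G : SimpleGraph (Fin n)) (e : Option (VertexPair n)) : ℝ :=
  if answer G e then -1 else 1

/-- `GramReachable T K` holds if `T` queries lead from an input-independent state to families of
states with Gram matrix `K`. Between two queries any input-independent isometry is allowed, so
only Gram matrices matter; the label sets may change along the way. -/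
inductive GramReachable : ℕ → (SimpleGraph (Fin n) → SimpleGraph (Fin n) → ℝ) → Prop
  | zero : GramReachable 0 (fun _ _ => 1)
  | succ {T : ℕ} {L : Type} [Fintype L] (q : L → Option (VertexPair n))
      (Ψ : SimpleGraph (Fin n) → L → ℝ) (h : GramReachable T (gram Ψ)) :
      GramReachable (T + 1) (gram fun G b => phase G (q b) * Ψ G b)

theorem phase_mul_self (G : SimpleGraph (Fin n)) (e : Option (VertexPair n)) :
    phase G e * phase G e = 1 := by
  unfold phase
  split_ifs <;> norm_num

theorem GramReachable.diag {T : ℕ} {K : SimpleGraph (Fin n) → SimpleGraph (Fin n) → ℝ}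
    (h : GramReachable T K) (G : SimpleGraph (Fin n)) : K G G = 1 := by
  induction h with
  | zero => rfl
  | succ q Ψ h ih =>
    rw [← ih]
    refine Finset.sum_congr rfl fun b _ => ?_
    linear_combination (Ψ G b * Ψ G b) * phase_mul_self G (q b)

/-- The state after `T` oracle calls, for a sequence `U` of unitary operators. -/
noncomputable def runState {W : Type} [Fintype W] [DecidableEq W] (init : BasisLabel n W)
    (U : ℕ → Matrix.unitaryGroup (BasisLabel n W) ℂ) (G : SimpleGraph (Fin n)) :
    ℕ → (BasisLabel n W → ℂ)
  | 0 => (U 0).1.mulVec (Pi.single init 1)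
  | t + 1 => (U (t + 1)).1.mulVec (oracle G (runState init U G t))

theorem runState_congr {W : Type} [Fintype W] [DecidableEq W] {init : BasisLabel n W}
    {U U' : ℕ → Matrix.unitaryGroup (BasisLabel n W) ℂ} (G : SimpleGraph (Fin n)) :
    ∀ T : ℕ, (∀ t ≤ T, U t = U' t) → runState init U G T = runState init U' G T
  | 0, h => by rw [runState, runState, h 0 le_rfl]
  | T + 1, h => by
    rw [runState, runState, h _ le_rfl, runState_congr G T fun t ht => h t (by omega)]

theorem state_eq_runState {T : ℕ} {W : Type} [Fintype W] [DecidableEq W]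
    (init : BasisLabel n W) (U : ℕ → Matrix.unitaryGroup (BasisLabel n W) ℂ)
    (r : BasisLabel n W → List Bool) (G : SimpleGraph (Fin n)) :
    ∀ (t : ℕ) (ht : t < T + 1),
      (QueryAlgorithm.mk W init (fun i : Fin (T + 1) => U i) r).state G t ht =
        runState init U G t
  | 0, _ => rfl
  | t + 1, ht => by
    rw [QueryAlgorithm.state, runState, state_eq_runState init U r G t]

theorem gram_orthonormal_combination {γ L B : Type*} [Fintype L] [Fintype B] [DecidableEq L]
    (χ : L → B → ℝ) (hχ : ∀ l l', ∑ b, χ l b * χ l' b = if l = l' then 1 else 0)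
    (Φ : γ → L → ℝ) : gram (fun x b => ∑ l, Φ x l * χ l b) = gram Φ := by
  funext x y
  calc ∑ b, (∑ l, Φ x l * χ l b) * (∑ l, Φ y l * χ l b)
      = ∑ b, ∑ l, ∑ l', (Φ x l * Φ y l') * (χ l b * χ l' b) := by
        refine Finset.sum_congr rfl fun b _ => ?_
        rw [Finset.sum_mul_sum]
        exact Finset.sum_congr rfl fun l _ => Finset.sum_congr rfl fun l' _ => by ring
    _ = ∑ l, ∑ l', (Φ x l * Φ y l') * ∑ b, χ l b * χ l' b := by
        rw [Finset.sum_comm]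
        refine Finset.sum_congr rfl fun l _ => ?_
        rw [Finset.sum_comm]
        exact Finset.sum_congr rfl fun l' _ => by rw [Finset.mul_sum]
    _ = gram Φ x y := by simp [hχ, gram]

/-- The vector of the basis state `|e⟩|w⟩` with the answer qubit in the state `|-⟩`. -/
noncomputable def kickback {W : Type} [DecidableEq W] (e : Option (VertexPair n)) (w : W)
    (b : BasisLabel n W) : ℝ :=
  if b.1 = e ∧ b.2.2 = w then (if b.2.1 then -1 else 1) / Real.sqrt 2 else 0

/-- Phase kickback: `|-⟩` is an eigenvector of the bit flip with eigenvalue `-1`, so the bit oracle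
acts on these vectors as a phase oracle. -/
theorem kickback_oracle {W : Type} [DecidableEq W] (G : SimpleGraph (Fin n))
    (e : Option (VertexPair n)) (w : W) (b : BasisLabel n W) :
    kickback e w (b.1, xor b.2.1 (answer G b.1), b.2.2) = phase G e * kickback e w b := by
  obtain ⟨e', q, w'⟩ := b
  by_cases h : e' = e ∧ w' = w
  · obtain ⟨rfl, rfl⟩ := h
    simp only [kickback, phase, and_self, if_true]
    cases q <;> cases answer G e' <;> simp <;> ring
  · simp [kickback, h]

theorem sum_kickback {W : Type} [Fintype W] [DecidableEq W] (e e' : Option (VertexPair n))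
    (w w' : W) :
    ∑ b : BasisLabel n W, kickback e w b * kickback e' w' b =
      if e = e' ∧ w = w' then 1 else 0 := by
  have h2 : (Real.sqrt 2)⁻¹ * (Real.sqrt 2)⁻¹ = 1 / 2 := by
    rw [← mul_inv, Real.mul_self_sqrt (by norm_num)]; norm_num
  have key : ∀ b : BasisLabel n W, kickback e w b * kickback e' w' b =
      if b.1 = e then (if b.2.2 = w then (if e = e' ∧ w = w' then 1 / 2 else 0) else 0) else 0 := by
    rintro ⟨x, q, y⟩
    simp only [kickback]
    by_cases hx : x = e
    · by_cases hy : y = w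
      · subst hx hy
        by_cases h : x = e' ∧ y = w'
        · simp only [h, and_self, if_true]
          cases q <;> simp [div_eq_mul_inv, h2]
        · simp [h]
      · simp [hy]
    · simp [hx]
  rw [Finset.sum_congr rfl fun b _ => key b, Fintype.sum_prod_type]
  simp only [Fintype.sum_prod_type, Fintype.sum_bool, Finset.sum_ite_eq', Finset.sum_ite_irrel,
    Finset.mem_univ, if_true, Finset.sum_const_zero]
  split_ifs <;> norm_num

/-- Every family of states with a reachable Gram matrix is produced by unitary operators in the
adjacency matrix model. -/
theorem GramReachable.exists_unitaries {T : ℕ}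
    {K : SimpleGraph (Fin n) → SimpleGraph (Fin n) → ℝ} (h : GramReachable T K) :
    ∃ m₀ : ℕ, ∀ m, m₀ ≤ m → ∀ Ψ : SimpleGraph (Fin n) → BasisLabel n (Fin m) → ℝ, gram Ψ = K →
      ∃ (init : BasisLabel n (Fin m)) (U : ℕ → Matrix.unitaryGroup (BasisLabel n (Fin m)) ℂ),
        ∀ G, runState init U G T = fun b => (Ψ G b : ℂ) := by
  classical
  induction h with
  | zero =>
    refine ⟨1, fun m hm Ψ hΨ => ?_⟩
    let init : BasisLabel n (Fin m) := (none, false, ⟨0, hm⟩)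
    obtain ⟨U, hU⟩ := exists_unitary_mulVec_eq (fun _ : SimpleGraph (Fin n) => Pi.single init 1)
      (fun G b => (Ψ G b : ℂ)) (by
        intro G G'
        have h1 : ∑ b, Ψ G b * Ψ G' b = 1 := congrFun (congrFun hΨ G) G'
        have h2 : ∑ b, (Ψ G b : ℂ) * (Ψ G' b : ℂ) = 1 := by exact_mod_cast h1
        simp [h2, Pi.single_apply])
    exact ⟨init, fun _ => U, fun G => hU G⟩
  | @succ T L _ q φ h ih =>
    obtain ⟨m₀, ih⟩ := ih
    -- The register size must serve all stages at once, so the induction allows every large `m`; `m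
    -- ≥ card L` leaves room for orthonormal kickback vectors indexed by `L`.
    refine ⟨max m₀ (Fintype.card L), fun m hm Ψ hΨ => ?_⟩
    obtain ⟨c⟩ : Nonempty (L ↪ Fin m) :=
      Function.Embedding.nonempty_of_card_le (by simpa using le_trans (le_max_right _ _) hm)
    let χ : L → BasisLabel n (Fin m) → ℝ := fun l => kickback (q l) (c l)
    have hχ : ∀ l l', ∑ b, χ l b * χ l' b = if l = l' then 1 else 0 := by
      intro l l'
      simp only [χ, sum_kickback]
      refine if_congr ⟨fun h => c.injective h.2, ?_⟩ rfl rfl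
      rintro rfl
      exact ⟨rfl, rfl⟩
    obtain ⟨init, U, hU⟩ := ih m (le_trans (le_max_left _ _) hm)
      (fun G b => ∑ l, φ G l * χ l b) (gram_orthonormal_combination χ hχ φ)
    have hO : ∀ G, oracle G (runState init U G T) =
        fun b => ((∑ l, (phase G (q l) * φ G l) * χ l b : ℝ) : ℂ) := by
      intro G
      funext b
      rw [hU]
      simp only [oracle]
      congr 1
      refine Finset.sum_congr rfl fun l _ => ?_
      rw [show χ l (b.1, xor b.2.1 (answer G b.1), b.2.2) = phase G (q l) * χ l b from
        kickback_oracle G _ _ b]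
      ring
    -- After the query the actual states have the Gram matrix of the target family, so one last
    -- unitary reaches it.
    obtain ⟨V, hV⟩ := exists_unitary_mulVec_eq (fun G => oracle G (runState init U G T))
      (fun G b => (Ψ G b : ℂ)) (by
        intro G G'
        have h1 : gram (fun G b => ∑ l, (phase G (q l) * φ G l) * χ l b) = gram Ψ :=
          (gram_orthonormal_combination χ hχ _).trans hΨ.symm
        have h2 := congrFun (congrFun h1 G) G'
        simp only [gram] at h2
        simp only [hO, RCLike.star_def, Complex.conj_ofReal]
        exact_mod_cast h2)
    refine ⟨init, Function.update U (T + 1) V, fun G => ?_⟩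
    rw [runState, Function.update_self, runState_congr (U' := U), hV]
    intro t ht
    exact Function.update_of_ne (by omega) _ _

/-- Within `T` queries one can output, on every graph `G`, an element of `S G` except with
probability at most `δ G`. -/
def SolvesWithin {Y : Type*} (T : ℕ) (S : SimpleGraph (Fin n) → Set Y)
    (δ : SimpleGraph (Fin n) → ℝ) : Prop :=
  ∃ (L : Type) (_ : Fintype L) (Ψ : SimpleGraph (Fin n) → L → ℝ) (f : L → Y),
    GramReachable T (gram Ψ) ∧
      ∀ G, ∑ b, Set.indicator {b | f b ∉ S G} (fun b => Ψ G b ^ 2) b ≤ δ G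

/-- Algorithms of the relaxed model are algorithms of the adjacency matrix model. -/
theorem SolvesWithin.exists_queryAlgorithm {T : ℕ} {S : SimpleGraph (Fin n) → Set (List Bool)}
    {δ : SimpleGraph (Fin n) → ℝ} (h : SolvesWithin T S δ) :
    ∃ A : QueryAlgorithm n T, ∀ G, 1 - δ G ≤ A.prob G (S G) := by
  classical
  obtain ⟨L, _, Ψ, f, hr, hδ⟩ := h
  obtain ⟨m₀, hm⟩ := hr.exists_unitaries
  obtain ⟨c⟩ : Nonempty (L ↪ Fin (max m₀ (Fintype.card L))) :=
    Function.Embedding.nonempty_of_card_le (by simp)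
  -- Unit norm forces `L` to be nonempty, which `Function.invFun` needs for decoding the work
  -- register.
  have hne : ∀ G : SimpleGraph (Fin n), ∃ l : L, Ψ G l ≠ 0 := by
    intro G
    by_contra hcon
    push Not at hcon
    have := hr.diag G
    simp [gram, hcon] at this
  obtain ⟨l₀, -⟩ := hne ⊥
  have : Nonempty L := ⟨l₀⟩
  let χ : L → BasisLabel n (Fin (max m₀ (Fintype.card L))) → ℝ :=
    fun l b => if b = (none, false, c l) then 1 else 0
  have hχ : ∀ l l', ∑ b, χ l b * χ l' b = if l = l' then 1 else 0 := by
    intro l l'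
    simp [χ, c.injective.eq_iff, eq_comm]
  obtain ⟨init, U, hU⟩ := hm _ (le_max_left _ _) (fun G b => ∑ l, Ψ G l * χ l b)
    (gram_orthonormal_combination χ hχ Ψ)
  refine ⟨QueryAlgorithm.mk _ init (fun i => U i)
    (fun b => f (Function.invFun c b.2.2)), fun G => ?_⟩
  have hst : ∀ l, ∑ l', Ψ G l' * χ l' (none, false, c l) = Ψ G l := by
    intro l
    simp [χ, c.injective.eq_iff]
  unfold QueryAlgorithm.prob
  rw [state_eq_runState, hU]
  have h1 : ∑ l, Ψ G l ^ 2 = 1 := by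
    rw [← hr.diag G]
    exact Finset.sum_congr rfl fun l _ => sq _
  have h2 : ∑ l, Set.indicator {b | f b ∉ S G} (fun b => Ψ G b ^ 2) l +
      ∑ l with f l ∈ S G, Ψ G l ^ 2 = 1 := by
    rw [← h1, Finset.sum_filter, ← Finset.sum_add_distrib]
    refine Finset.sum_congr rfl fun l _ => ?_
    by_cases hl : f l ∈ S G <;> simp [hl]
  have h3 : ∑ l with f l ∈ S G, Ψ G l ^ 2 ≤
      ∑ b with f (Function.invFun c b.2.2) ∈ S G,
        ‖((∑ l, Ψ G l * χ l b : ℝ) : ℂ)‖ ^ 2 := by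
    have hinj : Function.Injective
        (fun l : L => ((none, false, c l) : BasisLabel n (Fin (max m₀ (Fintype.card L))))) := by
      intro a b hab
      simpa using hab
    calc ∑ l with f l ∈ S G, Ψ G l ^ 2
        = ∑ l with f l ∈ S G, ‖((∑ l', Ψ G l' * χ l' (none, false, c l) : ℝ) : ℂ)‖ ^ 2 := by
          refine Finset.sum_congr rfl fun l _ => ?_
          rw [hst, Complex.norm_real, Real.norm_eq_abs, sq_abs]
      _ = ∑ b ∈ (Finset.univ.filter fun l => f l ∈ S G).image (fun l : L =>
            ((none, false, c l) : BasisLabel n (Fin (max m₀ (Fintype.card L))))),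
            ‖((∑ l, Ψ G l * χ l b : ℝ) : ℂ)‖ ^ 2 :=
          (Finset.sum_image (f := fun b => ‖((∑ l, Ψ G l * χ l b : ℝ) : ℂ)‖ ^ 2)
            fun a _ b _ hab => hinj hab).symm
      _ ≤ _ := by
          refine Finset.sum_le_sum_of_subset_of_nonneg ?_ fun _ _ _ => by positivity
          intro b hb
          obtain ⟨l, hl, rfl⟩ := Finset.mem_image.1 hb
          simpa [Function.leftInverse_invFun c.injective l] using hl
  refine le_trans ?_ h3
  linarith [hδ G]

end QuantumQuery

/-! ### Sequential composition and adaptive queries -/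

namespace QuantumQuery

variable {n : ℕ}

theorem GramReachable.eq_one {K : SimpleGraph (Fin n) → SimpleGraph (Fin n) → ℝ}
    (h : GramReachable 0 K) : K = fun _ _ => 1 := by
  cases h
  rfl

theorem GramReachable.exists_of_succ {T : ℕ} {K : SimpleGraph (Fin n) → SimpleGraph (Fin n) → ℝ}
    (h : GramReachable (T + 1) K) :
    ∃ (L : Type) (_ : Fintype L) (q : L → Option (VertexPair n))
      (Ψ : SimpleGraph (Fin n) → L → ℝ),
      GramReachable T (gram Ψ) ∧ K = gram fun G b => phase G (q b) * Ψ G b := by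
  cases h with
  | succ q Ψ h => exact ⟨_, _, q, Ψ, h, rfl⟩

theorem gram_sigma {γ L : Type*} [Fintype L] {L' : L → Type*} [∀ a, Fintype (L' a)]
    (Ψ : γ → L → ℝ) (Φ : ∀ a, γ → L' a → ℝ) :
    gram (fun x (b : Σ a, L' a) => Ψ x b.1 * Φ b.1 x b.2) =
      fun x y => ∑ a, Ψ x a * Ψ y a * gram (Φ a) x y := by
  funext x y
  rw [gram, Fintype.sum_sigma]
  refine Finset.sum_congr rfl fun a _ => ?_
  rw [gram, Finset.mul_sum]
  exact Finset.sum_congr rfl fun b _ => by ring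

/-- Sequential composition: the label of the first state selects the continuation. -/
theorem GramReachable.bind {T₁ : ℕ} {L : Type} [Fintype L] {Ψ : SimpleGraph (Fin n) → L → ℝ}
    (h₁ : GramReachable T₁ (gram Ψ)) : ∀ {T₂ : ℕ}
    {K : L → SimpleGraph (Fin n) → SimpleGraph (Fin n) → ℝ}, (∀ a, GramReachable T₂ (K a)) →
    GramReachable (T₁ + T₂) (fun G G' => ∑ a, Ψ G a * Ψ G' a * K a G G')
  | 0, K, h₂ => by
    have : K = fun _ _ _ => 1 := funext fun a => (h₂ a).eq_one
    subst this
    simp only [mul_one]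
    exact h₁
  | T₂ + 1, K, h₂ => by
    choose L' _ q Φ hΦ hK using fun a => (h₂ a).exists_of_succ
    -- Induction on the length of the continuations: strip their last queries, compose the rest, and
    -- then make all last queries at once, controlled by both labels.
    have ih := GramReachable.bind h₁ hΦ
    rw [← gram_sigma] at ih
    show GramReachable (T₁ + T₂ + 1) _
    convert ih.succ (fun b => q b.1 b.2) using 1
    rw [show K = fun a => gram fun G b => phase G (q a b) * Φ a G b from funext hK, ← gram_sigma]
    congr 1
    funext G b
    ring

theorem phase_none (G : SimpleGraph (Fin n)) : phase G none = 1 := by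
  simp [phase, answer]

theorem GramReachable.succ_idle {T : ℕ} {L : Type} [Fintype L]
    {Ψ : SimpleGraph (Fin n) → L → ℝ} (h : GramReachable T (gram Ψ)) :
    GramReachable (T + 1) (gram Ψ) := by
  simpa [phase_none] using h.succ (fun _ => none)

theorem GramReachable.mono {T T' : ℕ} {L : Type} [Fintype L]
    {Ψ : SimpleGraph (Fin n) → L → ℝ} (h : GramReachable T (gram Ψ)) (hT : T ≤ T') :
    GramReachable T' (gram Ψ) := by
  induction hT with
  | refl => exact h
  | step _ ih => exact ih.succ_idle

section SolvesWithin

variable {Y : Type*} {S : SimpleGraph (Fin n) → Set Y} {T : ℕ}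

theorem SolvesWithin.mono {T' : ℕ} {δ δ' : SimpleGraph (Fin n) → ℝ} (h : SolvesWithin T S δ)
    (hT : T ≤ T') (hδ : δ ≤ δ') : SolvesWithin T' S δ' := by
  obtain ⟨L, _, Ψ, f, hr, hf⟩ := h
  exact ⟨L, _, Ψ, f, hr.mono hT, fun G => (hf G).trans (hδ G)⟩

theorem gram_const_one {L : Type*} [Fintype L] {γ : Type*} {c : ℝ}
    (hc : Fintype.card L * c ^ 2 = 1) : gram (fun (_ : γ) (_ : L) => c) = fun _ _ => 1 := by
  funext x y
  simpa [gram, sq] using hc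

open Classical in
/-- Output without any query. -/
theorem SolvesWithin.pure (S : SimpleGraph (Fin n) → Set Y) (y : Y) :
    SolvesWithin 0 S (fun G => if y ∈ S G then 0 else 1) := by
  refine ⟨Unit, inferInstance, fun _ _ => 1, fun _ => y, ?_, fun G => ?_⟩
  · rw [gram_const_one (by simp)]
    exact .zero
  · by_cases h : y ∈ S G <;> simp [h]

theorem SolvesWithin.bind {T₁ : ℕ} {L : Type} [Fintype L] {Ψ : SimpleGraph (Fin n) → L → ℝ}
    (h₁ : GramReachable T₁ (gram Ψ)) {δ : L → SimpleGraph (Fin n) → ℝ}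
    (h₂ : ∀ a, SolvesWithin T S (δ a)) :
    SolvesWithin (T₁ + T) S (fun G => ∑ a, Ψ G a ^ 2 * δ a G) := by
  choose L' _ Φ f hr hf using h₂
  refine ⟨Σ a, L' a, inferInstance, fun G b => Ψ G b.1 * Φ b.1 G b.2, fun b => f b.1 b.2, ?_,
    fun G => ?_⟩
  · rw [gram_sigma]
    exact h₁.bind hr
  · rw [Fintype.sum_sigma]
    refine Finset.sum_le_sum fun a _ => ?_
    refine le_trans (le_of_eq ?_) (mul_le_mul_of_nonneg_left (hf a G) (sq_nonneg _))
    rw [Finset.mul_sum]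
    refine Finset.sum_congr rfl fun b _ => ?_
    by_cases hb : f a b ∈ S G <;> simp [hb, mul_pow]

/-- From a uniform qubit, querying `e` on one branch only gives `(|0⟩ ± |1⟩) / √2`. These states are
equal or orthogonal according to the answers, just like the basis states that display the answer. -/
theorem gramReachable_answer (e : Option (VertexPair n)) :
    GramReachable 1 (gram fun G (b : Bool) => if b = answer G e then (1 : ℝ) else 0) := by
  have h0 : GramReachable 0
      (gram fun (_ : SimpleGraph (Fin n)) (_ : Bool) => (Real.sqrt 2)⁻¹) := by
    rw [gram_const_one (by simp)]
    exact .zero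
  have h2 : (Real.sqrt 2)⁻¹ * (Real.sqrt 2)⁻¹ = 1 / 2 := by
    rw [← mul_inv, Real.mul_self_sqrt (by norm_num)]; norm_num
  convert h0.succ (fun b => if b then e else none) using 1
  funext G G'
  simp only [gram, Fintype.sum_bool, if_true, Bool.false_eq_true, if_false, phase_none]
  simp only [phase]
  cases answer G e <;> cases answer G' e <;> simp [h2] <;> norm_num

/-- Query `e` and continue according to the answer. -/
theorem SolvesWithin.query (e : Option (VertexPair n)) {δ₁ δ₀ : SimpleGraph (Fin n) → ℝ}
    (h₁ : SolvesWithin T S δ₁) (h₀ : SolvesWithin T S δ₀) :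
    SolvesWithin (1 + T) S (fun G => if answer G e then δ₁ G else δ₀ G) := by
  refine (SolvesWithin.bind (gramReachable_answer e) (δ := fun b => if b then δ₁ else δ₀)
    fun b => ?_).mono le_rfl fun G => le_of_eq ?_
  · cases b
    · exact h₀
    · exact h₁
  · cases h : answer G e <;> simp [h]

end SolvesWithin

/-! ### Grover iterations and their success probability -/

section Grover

variable {L : Type} [Fintype L] (q : L → Option (VertexPair n))

/-- The state of Grover's algorithm after `j` iterations on the search space `L`. -/
noncomputable def groverState (G : SimpleGraph (Fin n)) : ℕ → L → ℝ
  | 0 => fun _ => (Real.sqrt (Fintype.card L))⁻¹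
  | j + 1 => fun b => 2 * (∑ a, phase G (q a) * groverState G j a) / Fintype.card L -
      phase G (q b) * groverState G j b

/-- The reflection about the uniform vector is orthogonal, so Grover's diffusion step costs no
query. -/
theorem gram_reflection {γ : Type*} [Nonempty L] (Φ : γ → L → ℝ) :
    gram (fun x b => 2 * (∑ a, Φ x a) / Fintype.card L - Φ x b) = gram Φ := by
  funext x y
  have hX : ∑ a, Φ x a = Fintype.card L * ((∑ a, Φ x a) / Fintype.card L) := by field_simp
  have hY : ∑ a, Φ y a = Fintype.card L * ((∑ a, Φ y a) / Fintype.card L) := by field_simp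
  simp only [gram, mul_div_assoc]
  generalize (∑ a, Φ x a) / Fintype.card L = c at hX ⊢
  generalize (∑ a, Φ y a) / Fintype.card L = d at hY ⊢
  calc ∑ b, (2 * c - Φ x b) * (2 * d - Φ y b)
      = ∑ b, (4 * c * d - (2 * c) * Φ y b - (2 * d) * Φ x b + Φ x b * Φ y b) :=
        Finset.sum_congr rfl fun b _ => by ring
    _ = ∑ b, Φ x b * Φ y b := by
        rw [Finset.sum_add_distrib, Finset.sum_sub_distrib, Finset.sum_sub_distrib,
          Finset.sum_const, Finset.card_univ, nsmul_eq_mul, ← Finset.mul_sum, ← Finset.mul_sum,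
          hY, hX]
        ring

theorem gramReachable_groverState [Nonempty L] (j : ℕ) :
    GramReachable j (gram fun G => groverState q G j) := by
  induction j with
  | zero =>
    have : gram (fun G => groverState q G 0) = fun _ _ => 1 := by
      refine gram_const_one (c := (Real.sqrt (Fintype.card L))⁻¹) ?_
      rw [inv_pow, Real.sq_sqrt (by positivity)]
      exact mul_inv_cancel₀ (by simp)
    rw [this]
    exact .zero
  | succ j ih =>
    have := ih.succ q
    rwa [← gram_reflection] at this

/-- Marked and unmarked labels span an invariant plane, in which each iteration rotates by `2 * θ`.
Both classes must be nonempty for the two denominators. -/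
theorem groverState_eq (G : SimpleGraph (Fin n)) {m : ℕ} {θ : ℝ}
    (hm : (Finset.univ.filter fun b => answer G (q b) = true).card = m) (h0 : 0 < m)
    (hlt : m < Fintype.card L) (hs : Real.sin θ = Real.sqrt m / Real.sqrt (Fintype.card L))
    (hc : Real.cos θ = Real.sqrt (Fintype.card L - m) / Real.sqrt (Fintype.card L)) (j : ℕ)
    (b : L) :
    groverState q G j b = if answer G (q b) then Real.sin ((2 * j + 1) * θ) / Real.sqrt m
      else Real.cos ((2 * j + 1) * θ) / Real.sqrt (Fintype.card L - m) := by
  have hN : (0 : ℝ) < Fintype.card L := by exact_mod_cast h0.trans hlt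
  have hm0 : (0 : ℝ) < m := by exact_mod_cast h0
  have hNm : (0 : ℝ) < Fintype.card L - m := by
    have : (m : ℝ) < Fintype.card L := by exact_mod_cast hlt
    linarith
  have hNs := Real.sqrt_pos.2 hN
  have hms := Real.sqrt_pos.2 hm0
  have hNms := Real.sqrt_pos.2 hNm
  induction j generalizing b with
  | zero =>
    simp only [groverState, Nat.cast_zero, mul_zero, zero_add, one_mul, hs, hc]
    split_ifs <;> field_simp
  | succ j ih =>
    have hcard : ((Finset.univ.filter fun b => ¬ answer G (q b) = true).card : ℝ) =
        Fintype.card L - m := by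
      have := Finset.card_filter_add_card_filter_not (s := (Finset.univ : Finset L))
        (fun b => answer G (q b) = true)
      rw [hm, Finset.card_univ] at this
      rw [← this]
      push_cast
      ring
    -- The phase query reflects the angle `(2 * j + 1) * θ` to its negative, and the uniform vector
    -- lies at angle `θ`; their difference is `(2 * j + 2) * θ`.
    have hsum : ∑ a, phase G (q a) * groverState q G j a =
        Real.sqrt (Fintype.card L) * Real.cos ((2 * j + 2) * θ) := by
      have h1 : ∀ a, phase G (q a) * groverState q G j a =
          if answer G (q a) = true then -(Real.sin ((2 * j + 1) * θ) / Real.sqrt m)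
            else Real.cos ((2 * j + 1) * θ) / Real.sqrt (Fintype.card L - m) := by
        intro a
        rw [ih, phase]
        split_ifs <;> ring
      rw [Finset.sum_congr rfl fun a _ => h1 a, Finset.sum_ite, Finset.sum_const, Finset.sum_const,
        nsmul_eq_mul, nsmul_eq_mul, hcard, hm]
      rw [show (2 * (j : ℝ) + 2) * θ = (2 * j + 1) * θ + θ by ring, Real.cos_add, hs, hc]
      have e1 : (m : ℝ) = Real.sqrt m * Real.sqrt m := (Real.mul_self_sqrt hm0.le).symm
      have e2 : (Fintype.card L - m : ℝ) = Real.sqrt (Fintype.card L - m) *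
        Real.sqrt (Fintype.card L - m) := (Real.mul_self_sqrt hNm.le).symm
      calc (m : ℝ) * -(Real.sin ((2 * j + 1) * θ) / Real.sqrt m) + (Fintype.card L - m : ℝ) *
            (Real.cos ((2 * j + 1) * θ) / Real.sqrt (Fintype.card L - m))
          = (Real.sqrt m * Real.sqrt m) * -(Real.sin ((2 * j + 1) * θ) / Real.sqrt m) +
            (Real.sqrt (Fintype.card L - m) * Real.sqrt (Fintype.card L - m)) *
            (Real.cos ((2 * j + 1) * θ) / Real.sqrt (Fintype.card L - m)) := by
            rw [← e1, ← e2]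
        _ = _ := by field_simp; ring
    have e3 : (Fintype.card L : ℝ) =
        Real.sqrt (Fintype.card L) * Real.sqrt (Fintype.card L) := (Real.mul_self_sqrt hN.le).symm
    have hmean : 2 * (∑ a, phase G (q a) * groverState q G j a) / Fintype.card L =
        2 * Real.cos ((2 * j + 2) * θ) / Real.sqrt (Fintype.card L) := by
      rw [hsum]
      rw [div_eq_div_iff hN.ne' hNs.ne']
      linear_combination (-2 * Real.cos ((2 * j + 2) * θ)) * e3
    simp only [groverState]
    rw [hmean, ih, phase]
    have a1 : Real.sin ((2 * ((j + 1 : ℕ) : ℝ) + 1) * θ) = Real.sin ((2 * j + 1) * θ) +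
        2 * Real.cos ((2 * j + 2) * θ) * Real.sin θ := by
      rw [show (2 * ((j + 1 : ℕ) : ℝ) + 1) * θ = (2 * j + 2) * θ + θ by push_cast; ring,
        show (2 * (j : ℝ) + 1) * θ = (2 * j + 2) * θ - θ by ring, Real.sin_add, Real.sin_sub]
      ring
    have a2 : Real.cos ((2 * ((j + 1 : ℕ) : ℝ) + 1) * θ) = -Real.cos ((2 * j + 1) * θ) +
        2 * Real.cos ((2 * j + 2) * θ) * Real.cos θ := by
      rw [show (2 * ((j + 1 : ℕ) : ℝ) + 1) * θ = (2 * j + 2) * θ + θ by push_cast; ring,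
        show (2 * (j : ℝ) + 1) * θ = (2 * j + 2) * θ - θ by ring, Real.cos_add, Real.cos_sub]
      ring
    rw [a1, a2, hs, hc]
    split_ifs
    · field_simp
      ring
    · field_simp
      ring

end Grover

/-- Telescopes by `2 * sin (2 * θ) * cos a = sin (a + 2 * θ) - sin (a - 2 * θ)`. -/
theorem two_mul_sin_mul_sum_cos (θ : ℝ) (M : ℕ) :
    2 * Real.sin (2 * θ) * ∑ j ∈ Finset.range M, Real.cos (2 * ((2 * j + 1) * θ)) =
      Real.sin (4 * M * θ) := by
  induction M with
  | zero => simp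
  | succ M ih =>
    rw [Finset.sum_range_succ, mul_add, ih,
      show 4 * (M : ℝ) * θ = 2 * ((2 * M + 1) * θ) - 2 * θ by ring,
      show 4 * ((M + 1 : ℕ) : ℝ) * θ = 2 * ((2 * M + 1) * θ) + 2 * θ by push_cast; ring,
      Real.sin_sub, Real.sin_add]
    ring

/-- A uniformly random number of Grover iterations below `M` succeeds with probability `1/4`. -/
theorem quarter_le_sum_sin_sq {θ : ℝ} {M : ℕ} (hs : 0 < Real.sin (2 * θ))
    (hM : 1 ≤ M * Real.sin (2 * θ)) :
    (M : ℝ) / 4 ≤ ∑ j ∈ Finset.range M, Real.sin ((2 * j + 1) * θ) ^ 2 := by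
  have h1 : ∑ j ∈ Finset.range M, Real.sin ((2 * j + 1) * θ) ^ 2 =
      M / 2 - (∑ j ∈ Finset.range M, Real.cos (2 * ((2 * j + 1) * θ))) / 2 := by
    rw [Finset.sum_congr rfl fun j _ => Real.sin_sq_eq_half_sub _, Finset.sum_sub_distrib,
      Finset.sum_div]
    simp
    ring
  have h2 := two_mul_sin_mul_sum_cos θ M
  have h3 := Real.sin_le_one (4 * M * θ)
  rw [h1]
  set C := ∑ j ∈ Finset.range M, Real.cos (2 * ((2 * j + 1) * θ))
  have h4 : Real.sin (2 * θ) * C ≤ Real.sin (2 * θ) * (M / 2) := by nlinarith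
  have h5 := le_of_mul_le_mul_left h4 hs
  linarith

end QuantumQuery

/-! ### One search attempt with an unknown number of solutions -/

namespace QuantumQuery

variable {n : ℕ}

/-- The pairs in `D` that are edges of `G`. -/
noncomputable def hits (D : Finset (VertexPair n)) (G : SimpleGraph (Fin n)) :
    Finset (VertexPair n) :=
  D.filter fun e => answer G (some e) = true

/-- The queries of Grover's algorithm on `D`, padded with as many idle queries. -/
def paddedQuery (D : Finset (VertexPair n)) (a : D × Bool) : Option (VertexPair n) :=
  if a.2 then some a.1.1 else none

theorem card_paddedQuery (D : Finset (VertexPair n)) (G : SimpleGraph (Fin n)) :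
    (Finset.univ.filter fun a => answer G (paddedQuery D a) = true).card = (hits D G).card := by
  refine Finset.card_bij (fun a _ => a.1.1) ?_ ?_ ?_
  · rintro ⟨e, b⟩ h
    replace h := (Finset.mem_filter.1 h).2
    cases b
    · simp [paddedQuery, answer] at h
    · exact Finset.mem_filter.2 ⟨e.2, h⟩
  · rintro ⟨e, b⟩ h ⟨e', b'⟩ h' hee
    replace h := (Finset.mem_filter.1 h).2
    replace h' := (Finset.mem_filter.1 h').2
    cases b
    · simp [paddedQuery, answer] at h
    · cases b'
      · simp [paddedQuery, answer] at h'
      · exact Prod.ext (Subtype.ext hee) rfl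
  · intro e he
    have he' := Finset.mem_filter.1 he
    exact ⟨(⟨e, he'.1⟩, true), Finset.mem_filter.2 ⟨Finset.mem_univ _, he'.2⟩, rfl⟩

/-- The probability that `j` iterations of Grover's algorithm on the padded set `D` find an edge
of `G`, averaged over `j < M`. -/
noncomputable def searchProb (D : Finset (VertexPair n)) (M : ℕ) (G : SimpleGraph (Fin n)) : ℝ :=
  ∑ j : Fin M, (Real.sqrt M)⁻¹ ^ 2 *
    ∑ a, if answer G (paddedQuery D a) = true then groverState (paddedQuery D) G j a ^ 2 else 0

theorem sum_groverState_sq {L : Type} [Fintype L] [Nonempty L] (q : L → Option (VertexPair n))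
    (G : SimpleGraph (Fin n)) (j : ℕ) : ∑ a, groverState q G j a ^ 2 = 1 := by
  rw [← (gramReachable_groverState q j).diag G]
  exact Finset.sum_congr rfl fun _ _ => sq _

theorem sum_fin_inv_sqrt_sq {M : ℕ} (hM : 1 ≤ M) :
    ∑ _j : Fin M, (Real.sqrt M)⁻¹ ^ 2 = 1 := by
  rw [Finset.sum_const, Finset.card_univ, Fintype.card_fin, nsmul_eq_mul, inv_pow,
    Real.sq_sqrt (by positivity)]
  exact mul_inv_cancel₀ (by positivity)

theorem searchProb_nonneg (D : Finset (VertexPair n)) (M : ℕ) (G : SimpleGraph (Fin n)) :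
    0 ≤ searchProb D M G := by
  unfold searchProb
  positivity

theorem searchProb_le_one {D : Finset (VertexPair n)} (hD : D.Nonempty) {M : ℕ} (hM : 1 ≤ M)
    (G : SimpleGraph (Fin n)) : searchProb D M G ≤ 1 := by
  have : Nonempty D := hD.to_subtype
  rw [← sum_fin_inv_sqrt_sq hM]
  refine Finset.sum_le_sum fun j _ => mul_le_of_le_one_right (by positivity) ?_
  rw [← sum_groverState_sq (paddedQuery D) G j]
  refine Finset.sum_le_sum fun a _ => ?_
  split_ifs
  · exact le_rfl
  · positivity

theorem searchProb_eq_zero {D : Finset (VertexPair n)} (M : ℕ) {G : SimpleGraph (Fin n)}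
    (h : (hits D G).card = 0) : searchProb D M G = 0 := by
  rw [← card_paddedQuery, Finset.card_eq_zero, Finset.filter_eq_empty_iff] at h
  refine Finset.sum_eq_zero fun j _ => ?_
  rw [Finset.sum_eq_zero, mul_zero]
  intro a _
  rw [if_neg (h (Finset.mem_univ a))]

/-- Padding keeps the marked fraction at most one half, so `sin (2 * θ) ^ 2` is at least `(hits D
G).card / D.card` and `M * sin (2 * θ) ≥ 1`. No upper bound on the number of hits is needed. -/
theorem quarter_le_searchProb {D : Finset (VertexPair n)} {M : ℕ} (hM : 1 ≤ M)
    {G : SimpleGraph (Fin n)} (hpos : 0 < (hits D G).card)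
    (hMR : D.card ≤ M ^ 2 * (hits D G).card) : 1 / 4 ≤ searchProb D M G := by
  set m := (hits D G).card with hm
  have hmD : m ≤ D.card := Finset.card_filter_le _ _
  have hcard : Fintype.card (D × Bool) = 2 * D.card := by simp [mul_comm]
  have hlt : m < Fintype.card (D × Bool) := by omega
  have hN : (0 : ℝ) < (Fintype.card (D × Bool) : ℝ) := by exact_mod_cast hpos.trans hlt
  have hm0 : (0 : ℝ) < m := by exact_mod_cast hpos
  have hD0 : (0 : ℝ) < D.card := by exact_mod_cast hpos.trans_le hmD
  set N : ℝ := (Fintype.card (D × Bool) : ℝ) with hNdef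
  have hND : N = 2 * D.card := by rw [hNdef, hcard]; push_cast; ring
  have hmDr : (m : ℝ) ≤ D.card := by exact_mod_cast hmD
  have hNm : 0 < N - m := by rw [hND]; linarith
  have hs1 : Real.sqrt (m / N) ≤ 1 := by
    rw [Real.sqrt_le_iff, one_pow, div_le_one hN]
    exact ⟨zero_le_one, by linarith⟩
  have hs : Real.sin (Real.arcsin (Real.sqrt (m / N))) = Real.sqrt m / Real.sqrt N := by
    rw [Real.sin_arcsin (by linarith [Real.sqrt_nonneg (m / N)]) hs1, Real.sqrt_div hm0.le]
  have hc : Real.cos (Real.arcsin (Real.sqrt (m / N))) = Real.sqrt (N - m) / Real.sqrt N := by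
    rw [Real.cos_arcsin, Real.sq_sqrt (by positivity), ← Real.sqrt_div hNm.le]
    congr 1
    field_simp
  set θ := Real.arcsin (Real.sqrt (m / N))
  have hval := groverState_eq (paddedQuery D) G (card_paddedQuery D G) hpos hlt hs hc
  have hsin2 : Real.sin (2 * θ) ^ 2 = 4 * (m / N) * ((N - m) / N) := by
    rw [Real.sin_two_mul, mul_pow, mul_pow, hs, hc, div_pow, div_pow, Real.sq_sqrt hm0.le,
      Real.sq_sqrt hNm.le, Real.sq_sqrt hN.le]
    ring
  have hsinpos : 0 < Real.sin (2 * θ) := by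
    rw [Real.sin_two_mul, hs, hc]
    have := Real.sqrt_pos.2 hm0
    have := Real.sqrt_pos.2 hN
    have := Real.sqrt_pos.2 hNm
    positivity
  have hMs : 1 ≤ M * Real.sin (2 * θ) := by
    have h1 : (m : ℝ) / D.card ≤ Real.sin (2 * θ) ^ 2 := by
      rw [hsin2, hND]
      rw [show 4 * ((m : ℝ) / (2 * D.card)) * ((2 * D.card - m) / (2 * D.card)) =
        m / D.card * ((2 * D.card - m) / D.card) by field_simp; ring]
      refine le_mul_of_one_le_right (by positivity) ?_
      rw [le_div_iff₀ hD0]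
      linarith
    have h2 : (D.card : ℝ) ≤ M ^ 2 * m := by exact_mod_cast hMR
    have h3 : 1 ≤ (M * Real.sin (2 * θ)) ^ 2 := by
      rw [mul_pow]
      calc (1 : ℝ) ≤ M ^ 2 * (m / D.card) := by
            rw [← mul_div_assoc, le_div_iff₀ hD0]; linarith
        _ ≤ _ := by gcongr
    exact (one_le_sq_iff₀ (by positivity)).1 h3
  have hq := quarter_le_sum_sin_sq hsinpos hMs
  have hsum : ∀ j : ℕ, (∑ a, if answer G (paddedQuery D a) = true then
      groverState (paddedQuery D) G j a ^ 2 else 0) = Real.sin ((2 * j + 1) * θ) ^ 2 := by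
    intro j
    rw [← Finset.sum_filter, Finset.sum_congr rfl (g := fun _ =>
      (Real.sin ((2 * j + 1) * θ) / Real.sqrt m) ^ 2), Finset.sum_const, card_paddedQuery,
      nsmul_eq_mul, ← hm, div_pow, Real.sq_sqrt hm0.le]
    · field_simp
    · intro a ha
      rw [hval, if_pos (Finset.mem_filter.1 ha).2]
  unfold searchProb
  simp only [hsum]
  rw [← Finset.mul_sum, inv_pow, Real.sq_sqrt (by positivity),
    Fin.sum_univ_eq_sum_range (fun j : ℕ => Real.sin ((2 * j + 1) * θ) ^ 2) M]
  have hM0 : (0 : ℝ) < M := by exact_mod_cast hM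
  rw [inv_mul_eq_div, le_div_iff₀ hM0]
  linarith

/-- One attempt to find an edge of `G` in `D` with at most `M` queries: with probability
`searchProb D M G` one continues with a known edge in `D`. -/
theorem SolvesWithin.search {Y : Type*} {S : SimpleGraph (Fin n) → Set Y}
    {D : Finset (VertexPair n)} (hD : D.Nonempty) {M T : ℕ} (hM : 1 ≤ M)
    {δs : VertexPair n → SimpleGraph (Fin n) → ℝ} {δf : SimpleGraph (Fin n) → ℝ}
    (hs : ∀ e ∈ D, SolvesWithin T S (δs e)) (hf : SolvesWithin T S δf) :
    ∃ δ : SimpleGraph (Fin n) → ℝ, SolvesWithin (M + T) S δ ∧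
      ∀ (G : SimpleGraph (Fin n)) (a b : ℝ), (∀ e ∈ hits D G, δs e G ≤ a) → δf G ≤ b →
        δ G ≤ searchProb D M G * a + (1 - searchProb D M G) * b := by
  have : Nonempty D := hD.to_subtype
  let γ : D × Bool → SimpleGraph (Fin n) → ℝ := fun a G =>
    if answer G (paddedQuery D a) = true then δs a.1 G else δf G
  -- One more query tests the pair found, so the success branch holds a certain edge. With at most
  -- `M - 1` iterations this fits into `M` queries.
  have hγ : ∀ a, SolvesWithin (1 + T) S (γ a) := by
    rintro ⟨e, b⟩
    cases b
    · exact hf.mono (by omega) fun G => by simp [γ, paddedQuery, answer]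
    · exact (SolvesWithin.query (some e.1) (hs e e.2) hf).mono le_rfl fun G => by
        simp [γ, paddedQuery]
  -- A uniform superposition over `Fin M` stands in for the random number of iterations.
  have h0 : GramReachable 0
      (gram fun (_ : SimpleGraph (Fin n)) (_ : Fin M) => (Real.sqrt M)⁻¹) := by
    rw [gram_const_one]
    · exact .zero
    · rw [← sum_fin_inv_sqrt_sq hM]
      simp
  have hj : ∀ j : Fin M, SolvesWithin (M + T) S
      (fun G => ∑ a, groverState (paddedQuery D) G j a ^ 2 * γ a G) := fun j =>
    (SolvesWithin.bind (gramReachable_groverState (paddedQuery D) j) hγ).mono (by omega) le_rfl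
  refine ⟨_, (SolvesWithin.bind h0 hj).mono (by omega) le_rfl, fun G a b ha hb => ?_⟩
  have hγle : ∀ c, γ c G ≤ if answer G (paddedQuery D c) = true then a else b := by
    rintro ⟨e, c⟩
    simp only [γ]
    split_ifs with h
    · cases c
      · simp [paddedQuery, answer] at h
      · exact ha e (Finset.mem_filter.2 ⟨e.2, by simpa [paddedQuery] using h⟩)
    · exact hb
  have key : ∀ j : Fin M, ∑ c, groverState (paddedQuery D) G j c ^ 2 * γ c G ≤
      (∑ c, if answer G (paddedQuery D c) = true then
        groverState (paddedQuery D) G j c ^ 2 else 0) * (a - b) + b := by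
    intro j
    have h1 := sum_groverState_sq (paddedQuery D) G j
    calc ∑ c, groverState (paddedQuery D) G j c ^ 2 * γ c G
        ≤ ∑ c, groverState (paddedQuery D) G j c ^ 2 *
            (if answer G (paddedQuery D c) = true then a else b) :=
          Finset.sum_le_sum fun c _ => mul_le_mul_of_nonneg_left (hγle c) (sq_nonneg _)
      _ = ∑ c, ((if answer G (paddedQuery D c) = true then
            groverState (paddedQuery D) G j c ^ 2 else 0) * (a - b) +
            groverState (paddedQuery D) G j c ^ 2 * b) := by
          refine Finset.sum_congr rfl fun c _ => ?_
          split_ifs <;> ring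
      _ = _ := by rw [Finset.sum_add_distrib, ← Finset.sum_mul, ← Finset.sum_mul, h1, one_mul]
  calc _ ≤ ∑ j : Fin M, (Real.sqrt M)⁻¹ ^ 2 * ((∑ c, if answer G (paddedQuery D c) = true then
          groverState (paddedQuery D) G j c ^ 2 else 0) * (a - b) + b) :=
        Finset.sum_le_sum fun j _ => mul_le_mul_of_nonneg_left (key j) (sq_nonneg _)
    _ = searchProb D M G * (a - b) + (∑ _j : Fin M, (Real.sqrt M)⁻¹ ^ 2) * b := by
        rw [searchProb, Finset.sum_mul, Finset.sum_mul, ← Finset.sum_add_distrib]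
        exact Finset.sum_congr rfl fun j _ => by ring
    _ = _ := by rw [sum_fin_inv_sqrt_sq hM]; ring

end QuantumQuery

/-! ### Repeated search with a fixed query budget -/

namespace QuantumQuery

variable {n : ℕ}

theorem SolvesWithin.pure_le {Y : Type*} (S : SimpleGraph (Fin n) → Set Y) (y : Y) {T : ℕ} :
    ∃ δ : SimpleGraph (Fin n) → ℝ, SolvesWithin T S δ ∧
      ∀ G, δ G ≤ 1 ∧ (y ∈ S G → δ G ≤ 0) := by
  classical
  refine ⟨_, (SolvesWithin.pure S y).mono (Nat.zero_le T) le_rfl, fun G => ⟨?_, fun h => ?_⟩⟩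
  · split_ifs <;> norm_num
  · simp [h]

/-- One summation step of `∑ 1 / √i ≤ 2 * √r`: the next find costs at most `50 * √(N / R) ≤ 50 * √N
/ √r`, and the potential `100 * √N * √r` pays for it. -/
theorem max_add_sqrt_le {N R r : ℝ} (hr : 1 ≤ r) (hrR : r ≤ R) (hRN : R ≤ N) :
    max (32 * 1) (50 * Real.sqrt (N / R) - 8 * 1) + 100 * Real.sqrt N * Real.sqrt (r - 1) ≤
      100 * Real.sqrt N * Real.sqrt r := by
  have hR : 0 < R := by linarith
  have hX : 1 ≤ Real.sqrt (N / R) := Real.one_le_sqrt.2 ((one_le_div hR).2 hRN)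
  have h1 : max (32 * 1) (50 * Real.sqrt (N / R) - 8 * 1) ≤ 50 * Real.sqrt (N / R) :=
    max_le (by linarith) (by linarith)
  have h2 : Real.sqrt (N / R) ≤ Real.sqrt N / Real.sqrt r := by
    rw [← Real.sqrt_div (by linarith)]
    exact Real.sqrt_le_sqrt (div_le_div_of_nonneg_left (by linarith) (by linarith) hrR)
  have hs : 0 < Real.sqrt r := Real.sqrt_pos.2 (by linarith)
  have h3 : 1 / Real.sqrt r + 2 * Real.sqrt (r - 1) ≤ 2 * Real.sqrt r := by
    have e1 := Real.mul_self_sqrt (show 0 ≤ r by linarith)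
    have e2 := Real.mul_self_sqrt (show 0 ≤ r - 1 by linarith)
    have e3 : 1 / Real.sqrt r ≤ 2 * Real.sqrt r - 2 * Real.sqrt (r - 1) := by
      rw [div_le_iff₀ hs]
      nlinarith [sq_nonneg (Real.sqrt r - Real.sqrt (r - 1))]
    linarith
  calc _ ≤ 50 * (Real.sqrt N / Real.sqrt r) + 100 * Real.sqrt N * Real.sqrt (r - 1) := by
        linarith
    _ = 50 * Real.sqrt N * (1 / Real.sqrt r + 2 * Real.sqrt (r - 1)) := by ring
    _ ≤ 50 * Real.sqrt N * (2 * Real.sqrt r) := by gcongr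
    _ = _ := by ring

/-- Potential of a search at scale `x` with critical scale `X`. The constants solve `2 + 3 / 4 * (5
/ 4) * 32 = 32` (long attempts) and `2 - 5 / 4 * 8 = -8` (short ones); `50 = 5 / 4 * (32 + 8)` makes
the regimes switch at `X = x` after a failure. -/
theorem attempt_cost_le {x X P : ℝ} (hx : 1 ≤ x) (hP : 0 ≤ P) (hPX : X ≤ x → 1 / 4 ≤ P) :
    2 * x + (1 - P) * max (32 * (5 / 4 * x)) (50 * X - 8 * (5 / 4 * x)) ≤
      max (32 * x) (50 * X - 8 * x) := by
  rcases le_or_gt X x with h | h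
  · rw [max_eq_left (by linarith)]
    refine le_trans ?_ (le_max_left _ _)
    nlinarith [hPX h]
  · rw [max_eq_right (by linarith)]
    refine le_trans ?_ (le_max_right _ _)
    nlinarith

section RepeatedSearch

variable {Y σ : Type*} {S : SimpleGraph (Fin n) → Set Y} {D : σ → Finset (VertexPair n)}
  {next : σ → VertexPair n → σ} {Inv : σ → SimpleGraph (Fin n) → Prop} {μ : σ → ℕ} {N T : ℕ}
  {ε : ℝ} {κ : σ → SimpleGraph (Fin n) → ℝ}

/-- `B * (δ G - ε)` is in effect bounded by the expected cost, as in Markov's inequality. The bound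
adds the potential of the current search at scale `x` to that of all later finds, whose number is
below both the number of hits and `μ s`. -/
theorem exists_repeatedSearch_aux (hN : ∀ s, (D s).card ≤ N)
    (hInv : ∀ s G, Inv s G → ∀ e ∈ hits (D s) G, Inv (next s e) G ∧
      (hits (D (next s e)) G).card < (hits (D s) G).card ∧ μ (next s e) < μ s)
    (hε : 0 ≤ ε) (hκ : ∀ s, SolvesWithin T S (κ s)) (hκ₁ : ∀ s G, κ s G ≤ 1)
    (hκε : ∀ s G, Inv s G → (hits (D s) G).card = 0 → κ s G ≤ ε) (B : ℕ) :
    ∀ (s : σ) (x : ℝ), 1 ≤ x → ∃ δ : SimpleGraph (Fin n) → ℝ, SolvesWithin (B + T) S δ ∧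
      ∀ G, δ G ≤ 1 ∧ (Inv s G → (hits (D s) G).card = 0 → δ G ≤ ε) ∧
        (Inv s G → 0 < (hits (D s) G).card → B * (δ G - ε) ≤
          max (32 * x) (50 * Real.sqrt (N / (hits (D s) G).card) - 8 * x) +
            100 * Real.sqrt N * Real.sqrt ((min (hits (D s) G).card (μ s) : ℕ) - 1 : ℝ)) := by
  induction B using Nat.strong_induction_on with
  | _ B ih =>
  intro s x hx
  have hM1 : 1 ≤ ⌈x⌉₊ := Nat.one_le_ceil_iff.2 (by linarith)
  have hMx : (⌈x⌉₊ : ℝ) ≤ 2 * x := by linarith [Nat.ceil_lt_add_one (show 0 ≤ x by linarith)]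
  have hxM : x ≤ ⌈x⌉₊ := Nat.le_ceil x
  set M := ⌈x⌉₊
  -- If the budget does not cover the next attempt, stop: then `B < M ≤ 2 * x`, so even excess error
  -- `1` is within the bound.
  by_cases hcase : (D s).Nonempty ∧ M ≤ B
  swap
  · refine ⟨κ s, (hκ s).mono (by omega) le_rfl, fun G => ⟨hκ₁ s G, hκε s G, fun hI hpos => ?_⟩⟩
    have hne : (D s).Nonempty :=
      (Finset.card_pos.1 hpos).mono (Finset.filter_subset _ _)
    have hBM : B < M := by
      by_contra hcon
      exact hcase ⟨hne, by omega⟩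
    have hBM' : (B : ℝ) ≤ M := by exact_mod_cast hBM.le
    have h1 : (B : ℝ) * (κ s G - ε) ≤ B * 1 :=
      mul_le_mul_of_nonneg_left (by linarith [hκ₁ s G]) (by positivity)
    have h2 := le_max_left (32 * x) (50 * Real.sqrt (N / (hits (D s) G).card) - 8 * x)
    have h3 : 0 ≤ 100 * Real.sqrt N *
      Real.sqrt ((min (hits (D s) G).card (μ s) : ℕ) - 1 : ℝ) := by positivity
    linarith
  obtain ⟨hne, hMB⟩ := hcase
  obtain ⟨B', rfl⟩ := Nat.exists_eq_add_of_le hMB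
  have ihB := ih B' (by omega)
  -- A find resets the scale to `1`; a failure multiplies it by `5 / 4`.
  choose δs hδs hδs' using fun e => ihB (next s e) 1 le_rfl
  obtain ⟨δf, hδf, hδf'⟩ := ihB s (5 / 4 * x) (by linarith)
  obtain ⟨δ, hδ, hδ'⟩ := SolvesWithin.search hne hM1 (fun e _ => hδs e) hδf
  have hδ1 : ∀ G, δ G ≤ 1 := fun G => by
    have := hδ' G 1 1 (fun e _ => (hδs' e G).1) (hδf' G).1
    linarith
  refine ⟨δ, hδ.mono (by omega) le_rfl, fun G => ⟨hδ1 G, fun hI h0 => ?_, fun hI hpos => ?_⟩⟩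
  · have := hδ' G 0 ε (by
      intro e he
      rw [Finset.card_eq_zero.1 h0] at he
      simp at he) ((hδf' G).2.1 hI h0)
    rw [searchProb_eq_zero M h0] at this
    linarith
  have hRN : ∀ s, (hits (D s) G).card ≤ N := fun s => (Finset.card_filter_le _ _).trans (hN s)
  have hμ : ∀ s, Inv s G → 0 < (hits (D s) G).card → 0 < μ s := by
    intro s hI hp
    obtain ⟨e, he⟩ := Finset.card_pos.1 hp
    exact (Nat.zero_le _).trans_lt (hInv s G hI e he).2.2
  set r := min (hits (D s) G).card (μ s) with hr
  have hr1 : 1 ≤ r := le_min hpos (hμ s hI hpos)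
  set V := 100 * Real.sqrt N * Real.sqrt ((r : ℕ) - 1 : ℝ) with hV
  have hV0 : 0 ≤ V := by positivity
  have hsucc : ∀ e ∈ hits (D s) G, (B' : ℝ) * (δs e G - ε) ≤ V := by
    intro e he
    obtain ⟨hI', hR', hμ'⟩ := hInv s G hI e he
    rcases Nat.eq_zero_or_pos (hits (D (next s e)) G).card with h0 | hp
    · have h1 := (hδs' e G).2.1 hI' h0
      exact (mul_nonpos_of_nonneg_of_nonpos (by positivity) (by linarith)).trans hV0
    · have h1 := (hδs' e G).2.2 hI' hp
      have h2 := hμ _ hI' hp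
      set r' := min (hits (D (next s e)) G).card (μ (next s e)) with hr'
      have hr'1 : 1 ≤ r' := le_min hp h2
      have hr'r : r' + 1 ≤ r := le_min
        ((Nat.succ_le_succ (min_le_left _ _)).trans hR')
        ((Nat.succ_le_succ (min_le_right _ _)).trans hμ')
      have h3 := max_add_sqrt_le (N := N) (R := (hits (D (next s e)) G).card) (r := r')
        (by exact_mod_cast hr'1) (by exact_mod_cast min_le_left _ _)
        (by exact_mod_cast hRN (next s e))
      refine h1.trans (h3.trans ?_)
      rw [hV]
      gcongr
      have : (r' : ℝ) + 1 ≤ r := by exact_mod_cast hr'r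
      linarith
  have hfail := (hδf' G).2.2 hI hpos
  rw [← hr, ← hV] at hfail
  set X := Real.sqrt (N / (hits (D s) G).card) with hX
  have hPX : X ≤ x → 1 / 4 ≤ searchProb (D s) M G := by
    intro h
    refine quarter_le_searchProb hM1 hpos ?_
    have hp' : (0 : ℝ) < (hits (D s) G).card := by exact_mod_cast hpos
    have h1 : (N : ℝ) / (hits (D s) G).card ≤ (M : ℝ) ^ 2 :=
      (Real.sqrt_le_left (by positivity)).1 (h.trans hxM)
    rw [div_le_iff₀ hp'] at h1
    have h2 : N ≤ M ^ 2 * (hits (D s) G).card := by exact_mod_cast h1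
    exact (hN s).trans h2
  have hP0 := searchProb_nonneg (D s) M G
  have hcost := attempt_cost_le hx hP0 hPX
  set P := searchProb (D s) M G
  set C := max (32 * (5 / 4 * x)) (50 * X - 8 * (5 / 4 * x))
  have hMle : (M : ℝ) * (δ G - ε) ≤ M * 1 :=
    mul_le_mul_of_nonneg_left (by linarith [hδ1 G]) (by positivity)
  have hmain : (B' : ℝ) * (δ G - ε) ≤ V + (1 - P) * C := by
    rcases Nat.eq_zero_or_pos B' with h0 | hB
    · have hC : 0 ≤ C := le_trans (by linarith) (le_max_left _ _)
      have hP1 : P ≤ 1 := searchProb_le_one hne hM1 G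
      rw [h0, Nat.cast_zero, zero_mul]
      exact add_nonneg hV0 (mul_nonneg (by linarith) hC)
    · have hB' : (0 : ℝ) < B' := by exact_mod_cast hB
      -- Divide the potentials by the remaining budget to get error bounds for the two branches, and
      -- average them.
      have h1 := hδ' G (ε + V / B') (ε + (C + V) / B')
        (fun e he => by
          have := hsucc e he
          rw [← sub_le_iff_le_add', le_div_iff₀ hB']
          linarith)
        (by
          rw [← sub_le_iff_le_add', le_div_iff₀ hB']
          linarith)
      have h2 : P * (ε + V / B') + (1 - P) * (ε + (C + V) / B') - ε =
          (V + (1 - P) * C) / B' := by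
        field_simp
        ring
      have h3 : δ G - ε ≤ (V + (1 - P) * C) / B' := by linarith
      rw [le_div_iff₀ hB'] at h3
      linarith
  push_cast
  linarith

/-- Repeatedly search for an edge of `G` in a candidate set `D s` that shrinks with every edge
found. If there are at most `μ s` successful searches among at most `N` candidates each, then
`O(√(N * μ s))` queries suffice, in expectation, to reach a state without candidates. -/
theorem exists_repeatedSearch (hN : ∀ s, (D s).card ≤ N)
    (hInv : ∀ s G, Inv s G → ∀ e ∈ hits (D s) G, Inv (next s e) G ∧
      (hits (D (next s e)) G).card < (hits (D s) G).card ∧ μ (next s e) < μ s)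
    (hε : 0 ≤ ε) (hκ : ∀ s, SolvesWithin T S (κ s)) (hκ₁ : ∀ s G, κ s G ≤ 1)
    (hκε : ∀ s G, Inv s G → (hits (D s) G).card = 0 → κ s G ≤ ε) {B : ℕ} (s : σ)
    (hB : 1000 * (Real.sqrt N * Real.sqrt (μ s)) ≤ B) :
    ∃ δ : SimpleGraph (Fin n) → ℝ, SolvesWithin (B + T) S δ ∧
      ∀ G, δ G ≤ 1 ∧ (Inv s G → δ G ≤ ε + 1 / 10) := by
  obtain ⟨δ, hδ, h⟩ := exists_repeatedSearch_aux hN hInv hε hκ hκ₁ hκε B s 1 le_rfl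
  refine ⟨δ, hδ, fun G => ⟨(h G).1, fun hI => ?_⟩⟩
  rcases Nat.eq_zero_or_pos (hits (D s) G).card with h0 | hpos
  · linarith [(h G).2.1 hI h0]
  obtain ⟨e, he⟩ := Finset.card_pos.1 hpos
  have hμ : 0 < μ s := (Nat.zero_le _).trans_lt (hInv s G hI e he).2.2
  have hRN : (hits (D s) G).card ≤ N := (Finset.card_filter_le _ _).trans (hN s)
  have h1 := (h G).2.2 hI hpos
  have h2 := max_add_sqrt_le (N := N) (R := (hits (D s) G).card)
    (r := (min (hits (D s) G).card (μ s) : ℕ)) (by exact_mod_cast le_min hpos hμ)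
    (by exact_mod_cast min_le_left _ _) (by exact_mod_cast hRN)
  have h3 : Real.sqrt (min (hits (D s) G).card (μ s) : ℕ) ≤ Real.sqrt (μ s) :=
    Real.sqrt_le_sqrt (by exact_mod_cast min_le_right _ _)
  have h4 : Real.sqrt N * Real.sqrt (min (hits (D s) G).card (μ s) : ℕ) ≤
    Real.sqrt N * Real.sqrt (μ s) := by gcongr
  have hBpos : (0 : ℝ) < B := by
    have : (0 : ℝ) < N := by exact_mod_cast hpos.trans_le hRN
    have : (0 : ℝ) < μ s := by exact_mod_cast hμ
    have : 0 < Real.sqrt N * Real.sqrt (μ s) := by positivity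
    linarith
  have h5 : (B : ℝ) * (δ G - ε) ≤ B * (1 / 10) := by linarith
  linarith [le_of_mul_le_mul_left h5 hBpos]

end RepeatedSearch

end QuantumQuery

/-! ### Kernelization from partial knowledge of the graph -/

namespace VCKernel

variable {n : ℕ}

open Classical in
theorem encodeInstance_congr {G₁ G₂ : SimpleGraph (Fin n)} {I₁ : G₁.Subgraph × ℤ}
    {I₂ : G₂.Subgraph × ℤ} (hv : ∀ v, v ∈ I₁.1.verts ↔ v ∈ I₂.1.verts)
    (ha : ∀ u v, I₁.1.Adj u v ↔ I₂.1.Adj u v) (hz : I₁.2 = I₂.2) :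
    encodeInstance I₁ = encodeInstance I₂ := by
  have h1 : (fun v => decide (v ∈ I₁.1.verts)) = fun v => decide (v ∈ I₂.1.verts) :=
    funext fun v => decide_eq_decide.2 (hv v)
  have h2 : (fun e : Fin (n * n) =>
      decide (I₁.1.Adj (finProdFinEquiv.symm e).1 (finProdFinEquiv.symm e).2)) = fun e =>
      decide (I₂.1.Adj (finProdFinEquiv.symm e).1 (finProdFinEquiv.symm e).2) :=
    funext fun e => decide_eq_decide.2 (ha _ _)
  rw [encodeInstance, encodeInstance, h1, h2, hz]

theorem neighborSet_top_deleteVerts (G : SimpleGraph (Fin n)) {X : Finset (Fin n)} {v : Fin n}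
    (hv : v ∉ X) :
    ((⊤ : G.Subgraph).deleteVerts (X : Set (Fin n))).neighborSet v = G.neighborSet v \ X := by
  ext w
  simp [hv, and_comm]

theorem degreeIn_congr {F G : SimpleGraph (Fin n)} (d : DegreeGraph) {X : Finset (Fin n)}
    {v : Fin n} (hv : v ∉ X) (h : F.neighborSet v = G.neighborSet v) :
    degreeIn d ((⊤ : F.Subgraph).deleteVerts (X : Set (Fin n))) v =
      degreeIn d ((⊤ : G.Subgraph).deleteVerts (X : Set (Fin n))) v := by
  cases d
  · simp only [degreeIn, h]
  · simp only [degreeIn, neighborSet_top_deleteVerts _ hv, h]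

/-- The source of the threshold `3 * k + 1`: it survives the loss of `2 * k` neighbours, so it
decides the test under both degree conventions. -/
theorem le_degreeIn (G : SimpleGraph (Fin n)) (d : DegreeGraph) {X : Finset (Fin n)} {v : Fin n}
    {k : ℕ} (hv : v ∉ X) (hX : X.card ≤ 2 * k) (h : 3 * k + 1 ≤ (G.neighborSet v).ncard) :
    k + 1 ≤ degreeIn d ((⊤ : G.Subgraph).deleteVerts (X : Set (Fin n))) v := by
  cases d
  · simp only [degreeIn]
    omega
  · simp only [degreeIn, neighborSet_top_deleteVerts _ hv]
    have := Set.le_ncard_sdiff (X : Set (Fin n)) (G.neighborSet v) (Set.toFinite _)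
    rw [Set.ncard_coe_finset] at this
    omega

theorem eliminate_top_deleteVerts (G : SimpleGraph (Fin n)) (d : DegreeGraph) (k : ℕ)
    (X : Finset (Fin n)) (z : ℤ) (v : Fin n) :
    eliminate d k ((⊤ : G.Subgraph).deleteVerts (X : Set (Fin n)), z) v =
      if k + 1 ≤ degreeIn d ((⊤ : G.Subgraph).deleteVerts (X : Set (Fin n))) v then
        ((⊤ : G.Subgraph).deleteVerts ((insert v X : Finset (Fin n)) : Set (Fin n)), z - 1)
      else ((⊤ : G.Subgraph).deleteVerts (X : Set (Fin n)), z) := by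
  unfold eliminate
  split_ifs with h
  · simp only [SimpleGraph.Subgraph.deleteVerts_deleteVerts, Finset.coe_insert,
      Set.union_singleton]
  · rfl

/-- If `F ≤ G` agrees with `G` around all vertices of `l`, except for vertices that have a large
degree in `F` already, then both graphs lose the same vertices. -/
theorem foldl_eliminate_eq {F G : SimpleGraph (Fin n)} (hFG : F ≤ G) (d : DegreeGraph) {k : ℕ} :
    ∀ (l : List (Fin n)) (X : Finset (Fin n)) (z : ℤ), l.Nodup → (∀ v ∈ l, v ∉ X) →
    X.card + l.length ≤ 2 * k →
    (∀ v ∈ l, F.neighborSet v = G.neighborSet v ∨ 3 * k + 1 ≤ (F.neighborSet v).ncard) →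
    ∃ (X' : Finset (Fin n)) (z' : ℤ), X ⊆ X' ∧
      l.foldl (eliminate d k) ((⊤ : F.Subgraph).deleteVerts (X : Set (Fin n)), z) =
        ((⊤ : F.Subgraph).deleteVerts (X' : Set (Fin n)), z') ∧
      l.foldl (eliminate d k) ((⊤ : G.Subgraph).deleteVerts (X : Set (Fin n)), z) =
        ((⊤ : G.Subgraph).deleteVerts (X' : Set (Fin n)), z') ∧
      ∀ v ∈ l, v ∉ X' → F.neighborSet v = G.neighborSet v
  | [], X, z, _, _, _, _ => ⟨X, z, subset_rfl, rfl, rfl, by simp⟩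
  | v :: l, X, z, hnd, hX, hcard, hsat => by
    rw [List.nodup_cons] at hnd
    have hvX := hX v (by simp)
    rw [List.length_cons] at hcard
    have hsat' : ∀ u ∈ l, F.neighborSet u = G.neighborSet u ∨
        3 * k + 1 ≤ (F.neighborSet u).ncard := fun u hu => hsat u (List.mem_cons_of_mem _ hu)
    -- `X.card + l.length ≤ 2 * k` is preserved and bounds the deletions at every step.
    have hlarge : 3 * k + 1 ≤ (F.neighborSet v).ncard →
        k + 1 ≤ degreeIn d ((⊤ : F.Subgraph).deleteVerts (X : Set (Fin n))) v ∧
        k + 1 ≤ degreeIn d ((⊤ : G.Subgraph).deleteVerts (X : Set (Fin n))) v := fun h =>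
      ⟨le_degreeIn F d hvX (by omega) h, le_degreeIn G d hvX (by omega)
        (h.trans (Set.ncard_le_ncard (fun w hw => hFG hw) (Set.toFinite _)))⟩
    have hiff : k + 1 ≤ degreeIn d ((⊤ : F.Subgraph).deleteVerts (X : Set (Fin n))) v ↔
        k + 1 ≤ degreeIn d ((⊤ : G.Subgraph).deleteVerts (X : Set (Fin n))) v := by
      rcases hsat v (by simp) with h | h
      · rw [degreeIn_congr d hvX h]
      · exact iff_of_true (hlarge h).1 (hlarge h).2
    rw [List.foldl_cons, List.foldl_cons, eliminate_top_deleteVerts, eliminate_top_deleteVerts]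
    by_cases hdeg : k + 1 ≤ degreeIn d ((⊤ : F.Subgraph).deleteVerts (X : Set (Fin n))) v
    · rw [if_pos hdeg, if_pos (hiff.1 hdeg)]
      obtain ⟨X', z', hsub, h1, h2, h3⟩ := foldl_eliminate_eq hFG d l (insert v X) (z - 1) hnd.2
        (by
          intro u hu
          rw [Finset.mem_insert, not_or]
          exact ⟨fun h => hnd.1 (h ▸ hu), hX u (List.mem_cons_of_mem _ hu)⟩)
        (by rw [Finset.card_insert_of_notMem hvX]; omega) hsat'
      refine ⟨X', z', (Finset.subset_insert _ _).trans hsub, h1, h2, fun u hu huX => ?_⟩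
      rcases List.mem_cons.1 hu with rfl | hu
      · exact absurd (hsub (Finset.mem_insert_self _ _)) huX
      · exact h3 u hu huX
    · rw [if_neg hdeg, if_neg fun h => hdeg (hiff.2 h)]
      obtain ⟨X', z', hsub, h1, h2, h3⟩ := foldl_eliminate_eq hFG d l X z hnd.2
        (fun u hu => hX u (List.mem_cons_of_mem _ hu)) (by omega) hsat'
      refine ⟨X', z', hsub, h1, h2, fun u hu huX => ?_⟩
      rcases List.mem_cons.1 hu with rfl | hu
      · exact (hsat u (by simp)).resolve_right fun h => hdeg (hlarge h).1
      · exact h3 u hu huX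

/-- Both runs delete the same vertices. An edge of `G` that survives has an endpoint in `l`, whose
neighbourhoods in `F` and `G` agree because it was not deleted, so the edge is in `F`. -/
theorem encodeInstance_foldl_eq {F G : SimpleGraph (Fin n)} (hFG : F ≤ G) (d : DegreeGraph)
    {k : ℕ} {l : List (Fin n)} (hnd : l.Nodup) (hlen : l.length ≤ 2 * k)
    (hsat : ∀ v ∈ l, F.neighborSet v = G.neighborSet v ∨ 3 * k + 1 ≤ (F.neighborSet v).ncard)
    (hcover : ∀ u v, G.Adj u v → u ∈ l ∨ v ∈ l) (z : ℤ) :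
    encodeInstance (l.foldl (eliminate d k) ((⊤ : F.Subgraph), z)) =
      encodeInstance (l.foldl (eliminate d k) ((⊤ : G.Subgraph), z)) := by
  obtain ⟨X, z', -, h1, h2, h3⟩ := foldl_eliminate_eq hFG d l ∅ z hnd (by simp)
    (by simpa using hlen) hsat
  simp only [Finset.coe_empty, SimpleGraph.Subgraph.deleteVerts_empty] at h1 h2
  rw [h1, h2]
  refine encodeInstance_congr (fun v => by simp) (fun u v => ?_) rfl
  simp only [SimpleGraph.Subgraph.deleteVerts_adj, SimpleGraph.Subgraph.verts_top, Set.mem_univ,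
    true_and, SimpleGraph.Subgraph.top_adj, Finset.mem_coe]
  refine and_congr_right fun hu => and_congr_right fun hv => ⟨fun h => hFG h, fun h => ?_⟩
  rcases hcover u v h with hul | hvl
  · have : v ∈ G.neighborSet u := h
    rwa [← h3 u hul hu] at this
  · have : u ∈ G.neighborSet v := h.symm
    rw [← h3 v hvl hv] at this
    exact SimpleGraph.Adj.symm this

/-! ### Matchings and graphs as finite sets of vertex pairs -/

/-- The vertices of the pairs in `H`. -/
noncomputable def endpoints (H : Finset (VertexPair n)) : Finset (Fin n) :=
  open Classical in Finset.univ.filter fun v => ∃ e ∈ H, v ∈ e.1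

theorem mem_endpoints {H : Finset (VertexPair n)} {v : Fin n} :
    v ∈ endpoints H ↔ ∃ e ∈ H, v ∈ e.1 := by
  simp [endpoints]

theorem card_endpoints_le (H : Finset (VertexPair n)) : (endpoints H).card ≤ 2 * H.card := by
  classical
  have hsub : endpoints H ⊆ H.biUnion fun e => e.1.toFinset := by
    intro v hv
    obtain ⟨e, he, hv⟩ := mem_endpoints.1 hv
    exact Finset.mem_biUnion.2 ⟨e, he, Sym2.mem_toFinset.2 hv⟩
  refine (Finset.card_le_card hsub).trans ?_
  rw [mul_comm]
  exact Finset.card_biUnion_le_card_mul _ _ _ fun e _ => by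
    rw [Sym2.card_toFinset]
    split_ifs <;> omega

/-- `H` is a matching of `G`. -/
structure IsPairMatching (H : Finset (VertexPair n)) (G : SimpleGraph (Fin n)) : Prop where
  mem_edgeSet : ∀ e ∈ H, e.1 ∈ G.edgeSet
  eq_of_mem : ∀ e ∈ H, ∀ e' ∈ H, ∀ v, v ∈ e.1 → v ∈ e'.1 → e = e'

/-- The subgraph of `G` formed by the edges in `H`. -/
noncomputable def IsPairMatching.toSubgraph {H : Finset (VertexPair n)} {G : SimpleGraph (Fin n)}
    (h : IsPairMatching H G) : G.Subgraph where
  verts := endpoints H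
  Adj u v := ∃ e ∈ H, e.1 = s(u, v)
  adj_sub := by
    rintro u v ⟨e, he, hev⟩
    have := h.mem_edgeSet e he
    rwa [hev] at this
  edge_vert := by
    rintro u v ⟨e, he, hev⟩
    exact mem_endpoints.2 ⟨e, he, by simp [hev]⟩
  symm := ⟨by
    rintro u v ⟨e, he, hev⟩
    exact ⟨e, he, hev.trans Sym2.eq_swap⟩⟩

/-- Any edge of a larger matching meets `endpoints H`, and there the partner is already prescribed
by `H`; so nothing is new. -/
theorem IsPairMatching.isMaximalMatching {H : Finset (VertexPair n)} {G : SimpleGraph (Fin n)}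
    (h : IsPairMatching H G)
    (hmax : ∀ u v, G.Adj u v → u ∈ endpoints H ∨ v ∈ endpoints H) :
    IsMaximalMatching h.toSubgraph := by
  have hex : ∀ v ∈ endpoints H, ∃ w, h.toSubgraph.Adj v w := by
    intro v hv
    obtain ⟨e, he, hve⟩ := mem_endpoints.1 hv
    exact ⟨Sym2.Mem.other hve, e, he, (Sym2.other_spec hve).symm⟩
  have hM : h.toSubgraph.IsMatching := by
    intro v hv
    obtain ⟨w, hw⟩ := hex v hv
    refine ⟨w, hw, fun w' hw' => ?_⟩
    obtain ⟨e, he, hev⟩ := hw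
    obtain ⟨e', he', hev'⟩ := hw'
    have := h.eq_of_mem e he e' he' v (by simp [hev]) (by simp [hev'])
    subst this
    rw [hev] at hev'
    exact (Sym2.congr_right.1 hev').symm
  refine ⟨hM, fun M' hM' hle => ?_⟩
  have key : ∀ u v, M'.Adj u v → u ∈ endpoints H → h.toSubgraph.Adj u v := by
    intro u v huv hu
    obtain ⟨w, hw⟩ := hex u hu
    have h1 := hM'.eq_of_adj_left huv (hle.2 hw)
    rwa [h1]
  have hadj : ∀ u v, M'.Adj u v → h.toSubgraph.Adj u v := by
    intro u v huv
    rcases hmax u v huv.adj_sub with hu | hv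
    · exact key u v huv hu
    · exact (key v u huv.symm hv).symm
  refine ⟨fun v hv => ?_, fun u v huv => hadj u v huv⟩
  obtain ⟨w, hw, -⟩ := hM' hv
  exact (hadj v w hw).fst_mem

theorem IsPairMatching.ncard_edgeSet {H : Finset (VertexPair n)} {G : SimpleGraph (Fin n)}
    (h : IsPairMatching H G) : h.toSubgraph.edgeSet.ncard = H.card := by
  have : h.toSubgraph.edgeSet = Subtype.val '' (H : Set (VertexPair n)) := by
    ext e
    induction e with
    | _ u v =>
    constructor
    · rintro ⟨e, he, hev⟩
      exact ⟨e, he, hev⟩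
    · rintro ⟨e, he, hev⟩
      exact ⟨e, he, hev⟩
  rw [this, Set.ncard_image_of_injective _ Subtype.val_injective, Set.ncard_coe_finset]

theorem IsPairMatching.foldl_mem_kernels {H : Finset (VertexPair n)} {G : SimpleGraph (Fin n)}
    (h : IsPairMatching H G)
    (hmax : ∀ u v, G.Adj u v → u ∈ endpoints H ∨ v ∈ endpoints H) (d : DegreeGraph) {k : ℕ}
    (hk : H.card ≤ k) :
    (endpoints H).toList.foldl (eliminate d k) ((⊤ : G.Subgraph), (k : ℤ)) ∈ kernels d G k :=
  ⟨h.toSubgraph, h.isMaximalMatching hmax, h.ncard_edgeSet.trans_le hk, _, Finset.nodup_toList _,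
    fun _ => Finset.mem_toList, rfl⟩

/-- Disjoint edges need distinct vertices in any cover. -/
theorem IsPairMatching.not_isYesInstance {H : Finset (VertexPair n)} {G : SimpleGraph (Fin n)}
    (h : IsPairMatching H G) {k : ℕ} (hk : k + 1 ≤ H.card) : ¬ IsYesInstance G k := by
  rintro ⟨S, hS, hcov⟩
  have hex : ∀ e ∈ H, ∃ v ∈ S, v ∈ e.1 := by
    rintro ⟨e, hd⟩ he
    have hadj := h.mem_edgeSet _ he
    induction e with
    | _ u v =>
    rcases hcov hadj with hu | hv
    · exact ⟨u, hu, by simp⟩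
    · exact ⟨v, hv, by simp⟩
  obtain ⟨e₀, he₀⟩ := Finset.card_pos.1 ((Nat.succ_pos k).trans_le hk)
  obtain ⟨v₀, -⟩ := hex e₀ he₀
  have : Nonempty (Fin n) := ⟨v₀⟩
  choose! f hf hfe using hex
  have := Finset.card_le_card_of_injOn f hf fun e he e' he' hee =>
    h.eq_of_mem e he e' he' (f e) (hfe e he) (hee ▸ hfe e' he')
  omega

/-- The graph with edge set `F`. -/
def pairGraph (F : Finset (VertexPair n)) : SimpleGraph (Fin n) where
  Adj u v := ∃ e ∈ F, e.1 = s(u, v)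
  symm := ⟨by
    rintro u v ⟨e, he, hev⟩
    exact ⟨e, he, hev.trans Sym2.eq_swap⟩⟩
  loopless := ⟨by
    rintro u ⟨e, he, hev⟩
    exact e.2 (by simp [hev])⟩

open Classical in
/-- The number of pairs in `F` that contain `v`. -/
noncomputable def pairDegree (F : Finset (VertexPair n)) (v : Fin n) : ℕ :=
  (F.filter fun e => v ∈ e.1).card

theorem pairDegree_mono {F F' : Finset (VertexPair n)} (h : F ⊆ F') (v : Fin n) :
    pairDegree F v ≤ pairDegree F' v :=
  Finset.card_le_card (Finset.filter_subset_filter _ h)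

open Classical in
theorem pairDegree_insert {F : Finset (VertexPair n)} {e : VertexPair n} (he : e ∉ F) {v : Fin n}
    (hv : v ∈ e.1) : pairDegree (insert e F) v = pairDegree F v + 1 := by
  rw [pairDegree, Finset.filter_insert, if_pos hv, Finset.card_insert_of_notMem (by simp [he])]
  rfl

theorem pairDegree_le_ncard (F : Finset (VertexPair n)) (v : Fin n) :
    pairDegree F v ≤ ((pairGraph F).neighborSet v).ncard := by
  classical
  rw [pairDegree, ← Set.ncard_coe_finset, ← Set.ncard_image_of_injective _ Subtype.val_injective]
  refine (Set.ncard_le_ncard (t := (fun w => s(v, w)) '' (pairGraph F).neighborSet v) ?_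
    (Set.toFinite _)).trans (Set.ncard_image_le (Set.toFinite _))
  rintro _ ⟨e, he, rfl⟩
  obtain ⟨heF, hv⟩ := Finset.mem_filter.1 (Finset.mem_coe.1 he)
  exact ⟨Sym2.Mem.other hv, ⟨e, heF, (Sym2.other_spec hv).symm⟩, Sym2.other_spec hv⟩

theorem card_le_of_forall_exists_mem {D : Finset (VertexPair n)} {V : Finset (Fin n)}
    (h : ∀ e ∈ D, ∃ v ∈ V, v ∈ e.1) : D.card ≤ V.card * n := by
  classical
  have hsub : D.image Subtype.val ⊆
      (V ×ˢ (Finset.univ : Finset (Fin n))).image fun p => s(p.1, p.2) := by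
    intro x hx
    obtain ⟨e, he, rfl⟩ := Finset.mem_image.1 hx
    obtain ⟨v, hv, hve⟩ := h e he
    exact Finset.mem_image.2 ⟨(v, Sym2.Mem.other hve), by simp [hv], Sym2.other_spec hve⟩
  have := (Finset.card_le_card hsub).trans Finset.card_image_le
  rw [Finset.card_image_of_injective _ Subtype.val_injective] at this
  simpa using this

end VCKernel

/-! ### The two search rounds -/

namespace VCKernel

variable {n : ℕ}

theorem answer_some_eq_true {G : SimpleGraph (Fin n)} {e : VertexPair n} :
    answer G (some e) = true ↔ e.1 ∈ G.edgeSet := by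
  simp [answer]

theorem mem_hits {D : Finset (VertexPair n)} {G : SimpleGraph (Fin n)} {e : VertexPair n} :
    e ∈ hits D G ↔ e ∈ D ∧ e.1 ∈ G.edgeSet := by
  rw [hits, Finset.mem_filter, answer_some_eq_true]

theorem card_hits_lt {D D' : Finset (VertexPair n)} {G : SimpleGraph (Fin n)} {e : VertexPair n}
    (he : e ∈ hits D G) (hsub : D' ⊆ D) (he' : e ∉ D') : (hits D' G).card < (hits D G).card := by
  refine Finset.card_lt_card ⟨fun x hx => ?_, fun h => ?_⟩
  · rw [mem_hits] at hx ⊢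
    exact ⟨hsub hx.1, hx.2⟩
  · exact he' (mem_hits.1 (h he)).1

open Classical in
/-- The pairs at endpoints of `H` that are not known to be edges and have an endpoint in
`endpoints H` with less than `c` known edges. -/
noncomputable def unsaturatedPairs (H : Finset (VertexPair n)) (c : ℕ)
    (F : Finset (VertexPair n)) : Finset (VertexPair n) :=
  Finset.univ.filter fun e => e ∉ F ∧ ∃ v ∈ endpoints H, v ∈ e.1 ∧ pairDegree F v < c

theorem mem_unsaturatedPairs {H F : Finset (VertexPair n)} {c : ℕ} {e : VertexPair n} :
    e ∈ unsaturatedPairs H c F ↔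
      e ∉ F ∧ ∃ v ∈ endpoints H, v ∈ e.1 ∧ pairDegree F v < c := by
  simp [unsaturatedPairs]

open Classical in
theorem unsaturatedPairs_insert {H F : Finset (VertexPair n)} {c : ℕ} {e : VertexPair n} :
    unsaturatedPairs H c (insert e F) ⊆ unsaturatedPairs H c F := by
  intro x hx
  obtain ⟨h1, v, hv, hve, hd⟩ := mem_unsaturatedPairs.1 hx
  exact mem_unsaturatedPairs.2 ⟨fun h => h1 (Finset.mem_insert_of_mem h), v, hv, hve,
    (pairDegree_mono (Finset.subset_insert _ _) v).trans_lt hd⟩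

-- This total deficit is the measure `μ` of the second round: a new edge lowers it at the
-- unsaturated endpoint that made it a candidate.
open Classical in
theorem sum_sub_pairDegree_insert_lt {H F : Finset (VertexPair n)} {c : ℕ} {e : VertexPair n}
    (he : e ∈ unsaturatedPairs H c F) :
    ∑ v ∈ endpoints H, (c - pairDegree (insert e F) v) <
      ∑ v ∈ endpoints H, (c - pairDegree F v) := by
  obtain ⟨h1, v, hv, hve, hd⟩ := mem_unsaturatedPairs.1 he
  refine Finset.sum_lt_sum (fun u _ => ?_) ⟨v, hv, ?_⟩
  · exact Nat.sub_le_sub_left (pairDegree_mono (Finset.subset_insert _ _) u) c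
  · rw [pairDegree_insert h1 hve]
    omega

/-- The kernel computed from the matching `H` and the known edges `F`. -/
noncomputable def kernelCode (d : DegreeGraph) (k : ℕ) (H F : Finset (VertexPair n)) : List Bool :=
  encodeInstance ((endpoints H).toList.foldl (eliminate d k) ((⊤ : (pairGraph F).Subgraph), (k : ℤ)))

/-- When no candidate is an edge, each endpoint of `H` is saturated or has all its edges in `F`, as
`encodeInstance_foldl_eq` requires. -/
theorem kernelCode_mem_correctOutputs (d : DegreeGraph) {k : ℕ} {H F : Finset (VertexPair n)}
    {G : SimpleGraph (Fin n)} (hH : IsPairMatching H G) (hk : H.card ≤ k)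
    (hmax : ∀ u v, G.Adj u v → u ∈ endpoints H ∨ v ∈ endpoints H)
    (hF : ∀ e ∈ F, e.1 ∈ G.edgeSet)
    (hsat : (hits (unsaturatedPairs H (3 * k + 1) F) G).card = 0) :
    kernelCode d k H F ∈ correctOutputs d G k := by
  refine Or.inl ⟨_, hH.foldl_mem_kernels hmax d hk, ?_⟩
  have hFG : pairGraph F ≤ G := by
    rintro u v ⟨e, he, hev⟩
    have := hF e he
    rwa [hev] at this
  refine encodeInstance_foldl_eq hFG d (Finset.nodup_toList _) ?_ (fun v hv => ?_)
    (fun u v huv => by simpa using hmax u v huv) k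
  · rw [Finset.length_toList]
    exact (card_endpoints_le H).trans (by omega)
  · rw [Finset.mem_toList] at hv
    rcases le_or_gt (3 * k + 1) (pairDegree F v) with h | h
    · exact Or.inr (h.trans (pairDegree_le_ncard F v))
    · refine Or.inl (Set.Subset.antisymm (fun w hw => hFG hw) fun w hw => ?_)
      have hadj : G.Adj v w := hw
      by_contra hcon
      have hmem : (⟨s(v, w), by simpa using hadj.ne⟩ : VertexPair n) ∈
          hits (unsaturatedPairs H (3 * k + 1) F) G :=
        mem_hits.2 ⟨mem_unsaturatedPairs.2 ⟨fun hin => hcon ⟨_, hin, rfl⟩, v, hv, by simp, h⟩,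
          hadj⟩
      rw [Finset.card_eq_zero.1 hsat] at hmem
      simp at hmem

/-- Given a maximal matching with at most `k` edges, compute the kernel. -/
theorem exists_solvesWithin_of_matching (d : DegreeGraph) {k B : ℕ} {H : Finset (VertexPair n)}
    (hk : H.card ≤ k)
    (hB : 1000 * (Real.sqrt (2 * k * n : ℕ) * Real.sqrt (2 * k * (3 * k + 1) : ℕ)) ≤ B) :
    ∃ δ : SimpleGraph (Fin n) → ℝ, SolvesWithin B (fun G => correctOutputs d G k) δ ∧
      ∀ G, δ G ≤ 1 ∧ (IsPairMatching H G →
        (∀ u v, G.Adj u v → u ∈ endpoints H ∨ v ∈ endpoints H) → δ G ≤ 1 / 10) := by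
  classical
  choose κ hκ hκ' using fun F : Finset (VertexPair n) =>
    SolvesWithin.pure_le (fun G => correctOutputs d G k) (kernelCode d k H F) (T := 0)
  have hV : (endpoints H).card ≤ 2 * k := (card_endpoints_le H).trans (by omega)
  -- The state is the set `F` of known edges. `H` stays fixed, but its being a maximal matching
  -- depends on `G` and so belongs to the invariant.
  obtain ⟨δ, hδ, h⟩ := exists_repeatedSearch (S := fun G => correctOutputs d G k)
    (D := unsaturatedPairs H (3 * k + 1)) (next := fun F e => insert e F)
    (Inv := fun F G => (IsPairMatching H G ∧
      ∀ u v, G.Adj u v → u ∈ endpoints H ∨ v ∈ endpoints H) ∧ ∀ e ∈ F, e.1 ∈ G.edgeSet)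
    (μ := fun F => ∑ v ∈ endpoints H, (3 * k + 1 - pairDegree F v)) (N := 2 * k * n)
    (ε := 0) (κ := κ) (B := B)
    (fun F => (card_le_of_forall_exists_mem fun e he => by
      obtain ⟨-, v, hv, hve, -⟩ := mem_unsaturatedPairs.1 he
      exact ⟨v, hv, hve⟩).trans (Nat.mul_le_mul_right n hV))
    (by
      rintro F G ⟨hH, hF⟩ e he
      obtain ⟨heD, heG⟩ := mem_hits.1 he
      refine ⟨⟨hH, fun x hx => ?_⟩, card_hits_lt he unsaturatedPairs_insert fun hcon => ?_,
        sum_sub_pairDegree_insert_lt heD⟩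
      · rcases Finset.mem_insert.1 hx with rfl | hx
        · exact heG
        · exact hF x hx
      · exact (mem_unsaturatedPairs.1 hcon).1 (Finset.mem_insert_self _ _))
    le_rfl hκ (fun F G => (hκ' F G).1)
    (fun F G hI h0 => (hκ' F G).2 (kernelCode_mem_correctOutputs d hI.1.1 hk hI.1.2 hI.2 h0))
    ∅ (by
      refine le_trans ?_ hB
      have : ∑ v ∈ endpoints H, (3 * k + 1 - pairDegree ∅ v) ≤ 2 * k * (3 * k + 1) :=
        (Finset.sum_le_card_nsmul _ _ (3 * k + 1) fun v _ => Nat.sub_le _ _).trans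
          (by rw [smul_eq_mul]; exact Nat.mul_le_mul_right _ hV)
      gcongr)
  refine ⟨δ, hδ, fun G => ⟨(h G).1, fun hH hmax => ?_⟩⟩
  have := (h G).2 ⟨⟨hH, hmax⟩, by simp⟩
  linarith

open Classical in
/-- The pairs that extend the matching `H`, as long as `H` has at most `k` edges. -/
noncomputable def extendingPairs (k : ℕ) (H : Finset (VertexPair n)) : Finset (VertexPair n) :=
  Finset.univ.filter fun e => H.card ≤ k ∧ ∀ v ∈ e.1, v ∉ endpoints H

theorem mem_extendingPairs {k : ℕ} {H : Finset (VertexPair n)} {e : VertexPair n} :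
    e ∈ extendingPairs k H ↔ H.card ≤ k ∧ ∀ v ∈ e.1, v ∉ endpoints H := by
  simp [extendingPairs]

theorem notMem_of_mem_extendingPairs {k : ℕ} {H : Finset (VertexPair n)} {e : VertexPair n}
    (he : e ∈ extendingPairs k H) : e ∉ H := by
  intro h
  have hv := Sym2.out_fst_mem e.1
  exact (mem_extendingPairs.1 he).2 _ hv (mem_endpoints.2 ⟨e, h, hv⟩)

open Classical in
theorem IsPairMatching.insert {k : ℕ} {H : Finset (VertexPair n)} {G : SimpleGraph (Fin n)}
    (h : IsPairMatching H G) {e : VertexPair n} (he : e ∈ hits (extendingPairs k H) G) :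
    IsPairMatching (insert e H) G := by
  obtain ⟨heD, heG⟩ := mem_hits.1 he
  have hdisj := (mem_extendingPairs.1 heD).2
  constructor
  · intro x hx
    rcases Finset.mem_insert.1 hx with rfl | hx
    · exact heG
    · exact h.mem_edgeSet x hx
  · intro x hx y hy v hvx hvy
    rcases Finset.mem_insert.1 hx with rfl | hxH <;> rcases Finset.mem_insert.1 hy with rfl | hyH
    · rfl
    · exact absurd (mem_endpoints.2 ⟨y, hyH, hvy⟩) (hdisj v hvx)
    · exact absurd (mem_endpoints.2 ⟨x, hxH, hvx⟩) (hdisj v hvy)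
    · exact h.eq_of_mem x hxH y hyH v hvx hvy

/-- The kernelization: find a maximal matching or a matching with `k + 1` edges, then compute the
kernel. -/
theorem exists_solvesWithin (d : DegreeGraph) (n : ℕ) {k B₁ B₂ : ℕ}
    (hB₁ : 1000 * (Real.sqrt (n * n : ℕ) * Real.sqrt (k + 1 : ℕ)) ≤ B₁)
    (hB₂ : 1000 * (Real.sqrt (2 * k * n : ℕ) * Real.sqrt (2 * k * (3 * k + 1) : ℕ)) ≤ B₂) :
    ∃ δ : SimpleGraph (Fin n) → ℝ, SolvesWithin (B₁ + B₂) (fun G => correctOutputs d G k) δ ∧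
      ∀ G, δ G ≤ 1 / 5 := by
  classical
  have hcont : ∀ H : Finset (VertexPair n), ∃ κ : SimpleGraph (Fin n) → ℝ,
      SolvesWithin B₂ (fun G => correctOutputs d G k) κ ∧ ∀ G, κ G ≤ 1 ∧
        (IsPairMatching H G → (hits (extendingPairs k H) G).card = 0 → κ G ≤ 1 / 10) := by
    intro H
    rcases le_or_gt H.card k with hk | hk
    · obtain ⟨δ, hδ, h⟩ := exists_solvesWithin_of_matching d hk hB₂
      refine ⟨δ, hδ, fun G => ⟨(h G).1, fun hH h0 => (h G).2 hH fun u v huv => ?_⟩⟩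
      by_contra hcon
      rw [not_or] at hcon
      have hmem : (⟨s(u, v), by simpa using huv.ne⟩ : VertexPair n) ∈
          hits (extendingPairs k H) G :=
        mem_hits.2 ⟨mem_extendingPairs.2 ⟨hk, fun w hw => by
          rcases Sym2.mem_iff.1 hw with rfl | rfl
          · exact hcon.1
          · exact hcon.2⟩, huv⟩
      rw [Finset.card_eq_zero.1 h0] at hmem
      simp at hmem
    -- More than `k` disjoint edges: rejecting is correct.
    · obtain ⟨δ, hδ, h⟩ := SolvesWithin.pure_le (fun G : SimpleGraph (Fin n) =>
        correctOutputs d G k) noString (T := B₂)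
      refine ⟨δ, hδ, fun G => ⟨(h G).1, fun hH _ => ((h G).2 (Or.inr ⟨rfl, ?_⟩)).trans ?_⟩⟩
      · exact hH.not_isYesInstance hk
      · norm_num
  choose κ hκ hκ' using hcont
  -- Here the state is the matching itself. `ε = 1 / 10` is the error of the second round, run as
  -- the continuation.
  obtain ⟨δ, hδ, h⟩ := exists_repeatedSearch (S := fun G => correctOutputs d G k)
    (D := extendingPairs k) (next := fun H e => insert e H) (Inv := IsPairMatching)
    (μ := fun H => k + 1 - H.card) (N := n * n) (ε := 1 / 10) (κ := κ) (B := B₁)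
    (fun H => by
      have := card_le_of_forall_exists_mem (D := extendingPairs k H) (V := Finset.univ)
        fun e _ => ⟨_, Finset.mem_univ _, Sym2.out_fst_mem e.1⟩
      simpa using this)
    (by
      intro H G hH e he
      have heD := (mem_hits.1 he).1
      have hcard := Finset.card_insert_of_notMem (notMem_of_mem_extendingPairs heD)
      have hk := (mem_extendingPairs.1 heD).1
      refine ⟨hH.insert he, card_hits_lt he (fun x hx => ?_) fun hcon => ?_, ?_⟩
      · obtain ⟨h1, h2⟩ := mem_extendingPairs.1 hx
        refine mem_extendingPairs.2 ⟨hk, fun v hv hvH => h2 v hv ?_⟩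
        obtain ⟨y, hy, hvy⟩ := mem_endpoints.1 hvH
        exact mem_endpoints.2 ⟨y, Finset.mem_insert_of_mem hy, hvy⟩
      · exact notMem_of_mem_extendingPairs hcon (Finset.mem_insert_self _ _)
      · simp only [hcard]
        omega)
    (by norm_num) hκ (fun H G => (hκ' H G).1) (fun H G => (hκ' H G).2) ∅ (by simpa using hB₁)
  refine ⟨δ, hδ, fun G => ((h G).2 ⟨by simp, by simp⟩).trans (by norm_num)⟩

/-- The two budgets are within the claimed query bound. -/
theorem ceil_add_ceil_le (n : ℕ) {k : ℕ} (hk : 1 ≤ k) :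
    ((⌈1000 * (Real.sqrt (n * n : ℕ) * Real.sqrt (k + 1 : ℕ))⌉₊ +
      ⌈1000 * (Real.sqrt (2 * k * n : ℕ) * Real.sqrt (2 * k * (3 * k + 1) : ℕ))⌉₊ : ℕ) : ℝ) ≤
      5000 * (Real.sqrt k * n + (k : ℝ) ^ (3 / 2 : ℝ) * Real.sqrt n) := by
  rcases Nat.eq_zero_or_pos n with rfl | hn
  · simp
  have hk' : (1 : ℝ) ≤ k := by exact_mod_cast hk
  have hn' : (1 : ℝ) ≤ n := by exact_mod_cast hn
  have hsk : 1 ≤ Real.sqrt k := Real.one_le_sqrt.2 hk'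
  have hpow : (k : ℝ) ^ (3 / 2 : ℝ) = k * Real.sqrt k := by
    rw [show (3 / 2 : ℝ) = 1 + 1 / 2 by norm_num, Real.rpow_add (by linarith), Real.rpow_one,
      Real.sqrt_eq_rpow]
  have h1 : Real.sqrt (n * n : ℕ) * Real.sqrt (k + 1 : ℕ) ≤ 2 * (Real.sqrt k * n) := by
    have e1 : Real.sqrt (n * n : ℕ) = n := by
      push_cast
      exact Real.sqrt_mul_self (by positivity)
    have e2 : Real.sqrt (k + 1 : ℕ) ≤ 2 * Real.sqrt k := by
      rw [Real.sqrt_le_left (by positivity), mul_pow, Real.sq_sqrt (by positivity)]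
      push_cast
      linarith
    rw [e1]
    calc (n : ℝ) * Real.sqrt (k + 1 : ℕ) ≤ n * (2 * Real.sqrt k) := by gcongr
      _ = _ := by ring
  have h2 : Real.sqrt (2 * k * n : ℕ) * Real.sqrt (2 * k * (3 * k + 1) : ℕ) ≤
      4 * (k * Real.sqrt k * Real.sqrt n) := by
    rw [← Real.sqrt_mul (by positivity), Real.sqrt_le_left (by positivity), mul_pow, mul_pow,
      mul_pow, Real.sq_sqrt (by positivity), Real.sq_sqrt (by positivity)]
    push_cast
    have : (k : ℝ) ^ 2 * n * 1 ≤ (k : ℝ) ^ 2 * n * k := by gcongr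
    nlinarith
  have h3 := Nat.ceil_lt_add_one (show 0 ≤ 1000 * (Real.sqrt (n * n : ℕ) *
    Real.sqrt (k + 1 : ℕ)) by positivity)
  have h4 := Nat.ceil_lt_add_one (show 0 ≤ 1000 * (Real.sqrt (2 * k * n : ℕ) *
    Real.sqrt (2 * k * (3 * k + 1) : ℕ)) by positivity)
  -- Absorbs the two roundings up; this is why `n = 0` is treated apart.
  have h5 : 1 ≤ Real.sqrt k * n := by nlinarith
  have h6 : 0 ≤ k * Real.sqrt k * Real.sqrt n := by positivity
  rw [hpow, Nat.cast_add]
  linarith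

end VCKernel

theorem mainTheorem2 :
    ∃ C : ℝ, ∀ (d : VCKernel.DegreeGraph) (n k : ℕ), 1 ≤ k →
      ∃ (T : ℕ) (A : QuantumQuery.QueryAlgorithm n T),
        (T : ℝ) ≤ C * (Real.sqrt k * n + (k : ℝ) ^ (3 / 2 : ℝ) * Real.sqrt n) ∧
        ∀ G : SimpleGraph (Fin n),
          2 / 3 ≤ A.prob G (VCKernel.correctOutputs d G k) := by
  refine ⟨5000, fun d n k hk => ?_⟩
  obtain ⟨δ, hδ, h⟩ := VCKernel.exists_solvesWithin d n (k := k) (Nat.le_ceil _) (Nat.le_ceil _)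
  obtain ⟨A, hA⟩ := hδ.exists_queryAlgorithm
  refine ⟨_, A, VCKernel.ceil_add_ceil_le n hk, fun G => le_trans ?_ (hA G)⟩
  linarith [h G]
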